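/- Let $M$ be a connected smooth manifold of dimension $n$, let $F_0:M\hookrightarrow\mathbb S^{n+1}\subset\mathbb R^{n+2}$ be a smooth embedding with smooth unit normal field $\nu_0$ (tangent to the sphere), and let $g_0$ be the induced metric, $\nabla^0$ its Levi-Civita connection and $A_0$ the shape operator, $d\nu_0=-dF_0\circ A_0$. Assume that $F_0$ is isoparametric, i.e. the principal curvatures (eigenvalues of $A_0$, with multiplicities) are constant on $M$; let $\lambda_1>\dots>\lambda_g$, $g\ge 1$, be the distinct ones, and write $\lambda_j=\cot\theta_j$ with $\theta_j\in(0,\pi)$. Let $$F_t=\cos t\,F_0+\sin t\,\nu_0,\qquad \nu_t=-\sin t\,F_0+\cos t\,\nu_0\qquad(t\in\mathbb R),$$ $$\hat F_0=\tfrac1{\sqrt2}(F_0+i\nu_0):M\to\mathbb C^{n+2},\qquad \hat g=\operatorname{Re}\,\hat F_0^*\langle\cdot,\cdot\rangle_h,\qquad \alpha(X,Y,Z)=g_0\big((\nabla^0_XA_0)Y,Z\big),$$ where $\langle\cdot,\cdot\rangle_h$ is the standard Hermitian inner product, and let $\nabla$ be the Levi-Civita connection of $\hat g$. A diffeomorphism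 $\tau:M\to M$ is called the reflection of $M$ in the $j$-th focal submanifold $F_{\theta_j}(M)$ if $$F_t\circ\tau=F_{2\theta_j-t}\quad\text{and}\quad \nu_t\circ\tau=-\nu_{2\theta_j-t}\qquad\text{for all }t\in\mathbb R.$$ Theorem (Symmetry identities). (a) If $M$ is compact, then for every $j\in\{1,\dots,g\}$ the reflection $\tau_j$ of $M$ in the $j$-th focal submanifold exists and is unique. (b) For every $j\in\{1,\dots,g\}$ for which the reflection $\tau_j$ exists (hence for all $j$ if $M$ is compact), $\tau_j$ is an involution and an isometry of $(M,\hat g)$, and for all $p\in M$ and $X,Y,Z\in T_pM$ $$\alpha_{|p}(X,Y,Z)=-\alpha_{|\tau_j(p)}(d\tau_{j|p}X,d\tau_{j|p}Y,d\tau_{j|p}Z),$$ i.e. $(\tau_j)_*\alpha=-\alpha$. Moreover, for all $i\ge 0$, $p\in M$ and $w_1,\dots,w_{3+i}\in T_pM$, $$(\nabla^i\alpha)_{|p}(w_1,\dots,w_{3+i})=-(\nabla^i\alpha)_{|\tau_j(p)}(d\tau_{j|p}w_1,\dots,d\tau_{j|p}w_{3+i}),$$ i.e. $\nabla^i\alpha=-(\tau_j)_*\nabla^i\alpha$.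 (c) If $\tau_1,\dots,\tau_g$ all exist (e.g. if $M$ is compact), then the subgroup $\langle\tau_1,\tau_g\rangle$ of $\mathrm{Diff}(M)$ is isomorphic to the dihedral group $D_g$ of order $2g$, by an isomorphism under which $\tau_1,\dots,\tau_g$ are exactly the $g$ reflections of $D_g$. -/

import Mathlib

open Set Module
open scoped Manifold ContDiff

noncomputable section

namespace Isoparametric

/-- Euclidean space of dimension `k`. -/
abbrev E (k : ℕ) : Type := EuclideanSpace ℝ (Fin k)

/-! ### Riemannian calculus on open subsets of `ℝⁿ` -/

section Coordinates

variable {n : ℕ}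

/-- The `i`-th standard basis vector of `ℝⁿ`. -/
def stdVec (i : Fin n) : E n := EuclideanSpace.single i (1 : ℝ)

/-- Raising an index: for a nondegenerate bilinear form `B` and a linear form `φ`, this is the vector
`u = ∑ₖ (∑ₗ Bᵏˡ φ(eₗ)) eₖ`, that is, the only `u` with `B u w = φ w` for all `w` (`B` symmetric). -/
def sharp (B : E n → E n → ℝ) (φ : E n → ℝ) : E n :=
  ∑ k, (∑ l, (Matrix.of fun a b => B (stdVec a) (stdVec b))⁻¹ k l * φ (stdVec l)) • stdVec k

/-- Christoffel symbols of the Levi-Civita connection of the metric `G`: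
`Γˣ(u, v)` is given by
`2 G(Γ(u, v), w) = ∂ᵤ G(v, w) + ∂ᵥ G(u, w) - ∂_w G(u, v)`, so that `∇ᵤ Y = ∂ᵤ Y + Γ(u, Y)`. -/
def christoffel (G : E n → E n → E n → ℝ) (x u v : E n) : E n :=
  sharp (G x) fun w =>
    (1 / 2 : ℝ) * (fderiv ℝ (fun y => G y v w) x u + fderiv ℝ (fun y => G y u w) x v
      - fderiv ℝ (fun y => G y u v) x w)

/-- Covariant derivative `(∇ᵤ A) v = ∂ᵤ (A v) + Γ(u, A v) - A (Γ(u, v))` of a field `A` of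
endomorphisms, with respect to the Levi-Civita connection of `G`. -/
def covDerivEnd (G : E n → E n → E n → ℝ) (A : E n → E n → E n) (x u v : E n) : E n :=
  fderiv ℝ (fun y => A y v) x u + christoffel G x u (A x v) - A x (christoffel G x u v)

/-- Covariant derivative of a field `T` of covariant `r`-tensors with respect to the Levi-Civita
connection of `G`; the new argument is the first one:
`(∇T)(w₀, w₁, …, w_r) = ∂_{w₀} T(w₁, …, w_r) - ∑ₛ T(w₁, …, Γ(w₀, wₛ), …, w_r)`. -/
def covDeriv (G : E n → E n → E n → ℝ) {r : ℕ} (T : E n → (Fin r → E n) → ℝ) :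
    E n → (Fin (r + 1) → E n) → ℝ :=
  fun x w => fderiv ℝ (fun y => T y (Fin.tail w)) x (w 0)
    - ∑ s : Fin r, T x (Function.update (Fin.tail w) s (christoffel G x (w 0) (Fin.tail w s)))

end Coordinates

/-! ### Oriented hypersurfaces of the unit sphere -/

section Hypersurface

variable {n : ℕ} {M : Type*} [TopologicalSpace M] [ChartedSpace (E n) M]

/-- `F` is a smooth embedding of the `n`-manifold `M` into the unit sphere of `ℝⁿ⁺²`, and `ν` is a
smooth unit normal field of `F` in the sphere. -/
structure IsOrientedHypersurface (F ν : M → E (n + 2)) : Prop where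
  contMDiff_F : ContMDiff (𝓡 n) 𝓘(ℝ, E (n + 2)) ∞ F
  norm_F : ∀ p, ‖F p‖ = 1
  isEmbedding_F : Topology.IsEmbedding F
  injective_deriv_F : ∀ p, Function.Injective (mvfderiv (𝓡 n) F p)
  contMDiff_ν : ContMDiff (𝓡 n) 𝓘(ℝ, E (n + 2)) ∞ ν
  norm_ν : ∀ p, ‖ν p‖ = 1
  inner_ν_F : ∀ p, inner ℝ (ν p) (F p) = 0
  inner_ν_deriv_F : ∀ p (X : TangentSpace (𝓡 n) p), inner ℝ (ν p) (mvfderiv (𝓡 n) F p X) = 0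

/-- The induced metric `g₀ = F^*⟨·,·⟩`. -/
def inducedMetric (F : M → E (n + 2)) (p : M) (X Y : TangentSpace (𝓡 n) p) : ℝ :=
  inner ℝ (mvfderiv (𝓡 n) F p X) (mvfderiv (𝓡 n) F p Y)

/-- The shape operator `A₀`, determined by `dν = -dF ∘ A₀`. -/
def shapeOperator (F ν : M → E (n + 2)) (p : M) : End ℝ (TangentSpace (𝓡 n) p) :=
  -((mvfderiv (𝓡 n) F p).toLinearMap.leftInverse ∘ₗ (mvfderiv (𝓡 n) ν p).toLinearMap)

/-- An isoparametric hypersurface of the sphere: the principal curvatures, with their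
multiplicities, are the same at all points. -/
structure IsIsoparametric (F ν : M → E (n + 2)) : Prop extends IsOrientedHypersurface F ν where
  finrank_eigenspace : ∀ (p q : M) (x : ℝ),
    finrank ℝ ((shapeOperator F ν p).eigenspace x) = finrank ℝ ((shapeOperator F ν q).eigenspace x)

/-- The lift `F̂₀ = (F + i ν) / √2` into `ℂⁿ⁺²`. Its values lie in the Stiefel manifold. -/
def lift (F ν : M → E (n + 2)) (p : M) : EuclideanSpace ℂ (Fin (n + 2)) :=
  WithLp.toLp 2 fun k => (1 / (Real.sqrt 2 : ℂ)) * ((F p k : ℂ) + Complex.I * (ν p k : ℂ))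

/-- The metric `ĝ = Re (F̂₀^*⟨·,·⟩_h)`, induced by the Lagrangian immersion into the quadric. -/
def gHat (F ν : M → E (n + 2)) (p : M) (X Y : TangentSpace (𝓡 n) p) : ℝ :=
  (inner ℂ (mvfderiv (𝓡 n) (lift F ν) p X) (mvfderiv (𝓡 n) (lift F ν) p Y)).re

/-! Tensor fields in the preferred chart `φ` at `p`: the coordinate expression at `x` of a tensor on
`M` is its pullback by `φ⁻¹`. -/

/-- The differential at `x` of the inverse of the chart at `p`. -/
def dChartSymm (p : M) (x : E n) : E n →L[ℝ] TangentSpace (𝓡 n) ((extChartAt (𝓡 n) p).symm x) :=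
  mfderiv 𝓘(ℝ, E n) (𝓡 n) (extChartAt (𝓡 n) p).symm x

/-- The differential at `q` of the chart at `p`. -/
def dChart (p q : M) : TangentSpace (𝓡 n) q →L[ℝ] E n :=
  mvfderiv (𝓡 n) (extChartAt (𝓡 n) p) q

/-- A field of bilinear forms on `M`, in the chart at `p`. -/
def metricInChart (G : ∀ q : M, TangentSpace (𝓡 n) q → TangentSpace (𝓡 n) q → ℝ) (p : M)
    (x u v : E n) : ℝ :=
  G ((extChartAt (𝓡 n) p).symm x) (dChartSymm p x u) (dChartSymm p x v)

/-- The shape operator, in the chart at `p`. -/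
def shapeInChart (F ν : M → E (n + 2)) (p : M) (x v : E n) : E n :=
  dChart p ((extChartAt (𝓡 n) p).symm x)
    (shapeOperator F ν ((extChartAt (𝓡 n) p).symm x) (dChartSymm p x v))

/-- The tensor `α(X, Y, Z) = g₀((∇⁰_X A₀) Y, Z)`, in the chart at `p`. Here `∇⁰` is the Levi-Civita
connection of `g₀`. -/
def alphaInChart (F ν : M → E (n + 2)) (p : M) (x : E n) (w : Fin 3 → E n) : ℝ :=
  metricInChart (inducedMetric F) p x
    (covDerivEnd (metricInChart (inducedMetric F) p) (shapeInChart F ν p) x (w 0) (w 1)) (w 2)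

/-- The iterated covariant derivative `∇ⁱα` with respect to the Levi-Civita connection `∇` of `ĝ`,
in the chart at `p`. -/
def nablaAlphaInChart (F ν : M → E (n + 2)) (p : M) :
    (i : ℕ) → E n → (Fin (3 + i) → E n) → ℝ
  | 0 => alphaInChart F ν p
  | i + 1 => covDeriv (metricInChart (gHat F ν) p) (nablaAlphaInChart F ν p i)

/-- The covariant `3`-tensor field `α` on `M`. -/
def alpha (F ν : M → E (n + 2)) (p : M) (X Y Z : TangentSpace (𝓡 n) p) : ℝ :=
  alphaInChart F ν p (extChartAt (𝓡 n) p p) ![dChart p p X, dChart p p Y, dChart p p Z]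

/-- The covariant `(3 + i)`-tensor field `∇ⁱα` on `M`. -/
def nablaAlpha (F ν : M → E (n + 2)) (i : ℕ) (p : M)
    (w : Fin (3 + i) → TangentSpace (𝓡 n) p) : ℝ :=
  nablaAlphaInChart F ν p i (extChartAt (𝓡 n) p p) fun s => dChart p p (w s)

/-- The parallel surface `F_t = cos t F₀ + sin t ν₀`. -/
def parallel (F ν : M → E (n + 2)) (t : ℝ) (p : M) : E (n + 2) :=
  Real.cos t • F p + Real.sin t • ν p

/-- The normal field `ν_t = -sin t F₀ + cos t ν₀` of the parallel surface. -/
def parallelNormal (F ν : M → E (n + 2)) (t : ℝ) (p : M) : E (n + 2) :=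
  -Real.sin t • F p + Real.cos t • ν p

/-- The angle `θ ∈ (0, π)` with `cot θ = c`; `F_θ` is the focal map of the principal
curvature `c`. -/
def focalAngle (c : ℝ) : ℝ := Real.pi / 2 - Real.arctan c

/-- `τ` is the reflection of `M` in the focal submanifold `F_θ(M)`:
`F_t ∘ τ = F_{2θ-t}` and `ν_t ∘ τ = -ν_{2θ-t}` for all `t`. -/
def IsFocalReflection (F ν : M → E (n + 2)) (θ : ℝ) (τ : M ≃ₘ^∞⟮𝓡 n, 𝓡 n⟯ M) : Prop :=
  ∀ (t : ℝ) (p : M), parallel F ν t (τ p) = parallel F ν (2 * θ - t) p ∧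
    parallelNormal F ν t (τ p) = -parallelNormal F ν (2 * θ - t) p

end Hypersurface

end Isoparametric

end

/-! Everything is read off from the pair (F, ν). Putting t = 0 in the definition, τ is the
reflection at focal distance θ exactly when it changes (F, ν) by the constant matrix with rows (cos
2θ, sin 2θ) and (sin 2θ, -cos 2θ); this is `ReflectsFrame`. The matrix is orthogonal, symmetric and
of determinant -1. Since F is injective, the matrix determines τ, which gives uniqueness and the
involution property, and later the group relations.

Symmetry. The metric ĝ is half of ⟨dF, dF⟩ + ⟨dν, dν⟩, so an orthogonal matrix preserves it. In
every chart α is ⟨D²F, dν⟩ - ⟨D²ν, dF⟩ (`alphaInChart_eq`). This expression is alternating in (F,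
ν), so the matrix multiplies it by its determinant (`cubicForm_reflection`). The Levi-Civita
connection is natural under isometries (`fderiv_christoffel`, `covDeriv_comp`), and the sign passes
to every ∇ⁱα.

Existence. The kernel of dF_θ is a principal space, so constant multiplicities give constant rank.
By the constant rank argument in `IsLegendrianOn.eventually_exists_circle`, F_θ stays fixed along
points where ν_θ runs through short great-circle arcs in the normal space. F_θ is not an immersion,
which is why `IsLegendrianOn` only asks the pair to be immersed. On a compact M the arcs continue up
to angle π (`exists_antipode`) and reach a point with the same F_θ and the opposite ν_θ. Sending p
to this point reflects the frame; the map is smooth because F ∘ τ is smooth and F is an embedding.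

Dihedral group. A focal reflection permutes focal distances modulo π, by t ↦ 2θ_j - t. A finite set
modulo π that is symmetric about each of its points is equally spaced (`eq_add_mul_pi_div`), so the
axes of the matrices are those of a regular g-gon. Composition of the τ_j is multiplication of the
matrices, and these form a dihedral group. -/

open Set Module
open scoped Manifold ContDiff RealInnerProductSpace

noncomputable section

namespace Isoparametric

/-! ### Maps and their differentials in the preferred charts -/

section Charts

variable {n : ℕ} {M : Type*} [TopologicalSpace M] [ChartedSpace (E n) M]
  {K : Type*}

/-- The expression of a vector-valued map in the preferred chart at `p`. -/
def inChart (f : M → K) (p : M) (x : E n) : K := f ((extChartAt (𝓡 n) p).symm x)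

theorem inChart_extChartAt (f : M → K) (p : M) :
    inChart f p (extChartAt (𝓡 n) p p) = f p := by
  simp [inChart]

variable [NormedAddCommGroup K] [NormedSpace ℝ K] [IsManifold (𝓡 n) ∞ M]

theorem contMDiffOn_extChartAt_symm' (p : M) :
    ContMDiffOn 𝓘(ℝ, E n) (𝓡 n) ∞ (extChartAt (𝓡 n) p).symm (extChartAt (𝓡 n) p).target :=
  contMDiffOn_extChartAt_symm p

theorem contDiffOn_inChart {f : M → K} (hf : ContMDiff (𝓡 n) 𝓘(ℝ, K) ∞ f) (p : M) :
    ContDiffOn ℝ ∞ (inChart f p) (extChartAt (𝓡 n) p).target :=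
  (hf.comp_contMDiffOn (contMDiffOn_extChartAt_symm' p)).contDiffOn

theorem mdifferentiableAt_extChartAt_symm {p : M} {x : E n}
    (hx : x ∈ (extChartAt (𝓡 n) p).target) :
    MDifferentiableAt 𝓘(ℝ, E n) (𝓡 n) (extChartAt (𝓡 n) p).symm x :=
  ((contMDiffOn_extChartAt_symm' p).contMDiffAt
    ((isOpen_extChartAt_target p).mem_nhds hx)).mdifferentiableAt (by simp)

theorem fderiv_inChart_of_mdifferentiableAt {f : M → K} {p : M} {x : E n}
    (hf : MDifferentiableAt (𝓡 n) 𝓘(ℝ, K) f ((extChartAt (𝓡 n) p).symm x))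
    (hx : x ∈ (extChartAt (𝓡 n) p).target) :
    fderiv ℝ (inChart f p) x
      = (mvfderiv (𝓡 n) f ((extChartAt (𝓡 n) p).symm x)).comp (dChartSymm p x) := by
  have := mfderiv_comp x hf (mdifferentiableAt_extChartAt_symm hx)
  rw [← mfderiv_eq_fderiv]
  exact this

theorem fderiv_inChart {f : M → K} (hf : ContMDiff (𝓡 n) 𝓘(ℝ, K) ∞ f) {p : M} {x : E n}
    (hx : x ∈ (extChartAt (𝓡 n) p).target) :
    fderiv ℝ (inChart f p) x
      = (mvfderiv (𝓡 n) f ((extChartAt (𝓡 n) p).symm x)).comp (dChartSymm p x) :=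
  fderiv_inChart_of_mdifferentiableAt (hf.mdifferentiable (by simp) _) hx

theorem dChartSymm_dChart {p : M} {x : E n} (hx : x ∈ (extChartAt (𝓡 n) p).target)
    (v : TangentSpace (𝓡 n) ((extChartAt (𝓡 n) p).symm x)) :
    dChartSymm p x (dChart p ((extChartAt (𝓡 n) p).symm x) v) = v := by
  have := mfderivWithin_extChartAt_symm_comp_mfderiv_extChartAt (I := 𝓡 n) hx
  rw [ModelWithCorners.range_eq_univ, mfderivWithin_univ] at this
  exact congrArg (fun L => L v) this

theorem dChart_dChartSymm {p : M} {x : E n} (hx : x ∈ (extChartAt (𝓡 n) p).target) (v : E n) :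
    dChart p ((extChartAt (𝓡 n) p).symm x) (dChartSymm p x v) = v := by
  have := mfderiv_extChartAt_comp_mfderivWithin_extChartAt_symm (I := 𝓡 n) hx
  rw [ModelWithCorners.range_eq_univ, mfderivWithin_univ] at this
  exact congrArg (fun L => L v) this

theorem fderiv_inChart_dChart_of_mdifferentiableAt {f : M → K} {p : M}
    (hf : MDifferentiableAt (𝓡 n) 𝓘(ℝ, K) f p) (X : TangentSpace (𝓡 n) p) :
    fderiv ℝ (inChart f p) (extChartAt (𝓡 n) p p) (dChart p p X) = mvfderiv (𝓡 n) f p X := by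
  -- The point `(extChartAt (𝓡 n) p).symm (extChartAt (𝓡 n) p p)` equals `p` only propositionally,
  -- and tangent vectors depend on it; a free point `q` lets the equation be eliminated.
  have h : ∀ q (_ : q = p) (X : TangentSpace (𝓡 n) q),
      MDifferentiableAt (𝓡 n) 𝓘(ℝ, K) f q →
      (extChartAt (𝓡 n) p).symm (extChartAt (𝓡 n) p p) = q →
      fderiv ℝ (inChart f p) (extChartAt (𝓡 n) p p) (dChart p q X) = mvfderiv (𝓡 n) f q X := by
    rintro q - X hf rfl
    have hx := mem_extChartAt_target (I := 𝓡 n) p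
    rw [fderiv_inChart_of_mdifferentiableAt hf hx, ContinuousLinearMap.comp_apply,
      dChartSymm_dChart hx]
  exact h p rfl X hf (by simp)

theorem fderiv_inChart_dChart {f : M → K} (hf : ContMDiff (𝓡 n) 𝓘(ℝ, K) ∞ f) (p : M)
    (X : TangentSpace (𝓡 n) p) :
    fderiv ℝ (inChart f p) (extChartAt (𝓡 n) p p) (dChart p p X) = mvfderiv (𝓡 n) f p X :=
  fderiv_inChart_dChart_of_mdifferentiableAt (hf.mdifferentiable (by simp) p) X

theorem range_fderiv_inChart {f : M → K} (hf : ContMDiff (𝓡 n) 𝓘(ℝ, K) ∞ f) {p : M} {x : E n}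
    (hx : x ∈ (extChartAt (𝓡 n) p).target) :
    (fderiv ℝ (inChart f p) x).range =
      (mvfderiv (𝓡 n) f ((extChartAt (𝓡 n) p).symm x)).range := by
  rw [fderiv_inChart hf hx]
  apply le_antisymm
  · rintro _ ⟨v, rfl⟩
    exact ⟨_, rfl⟩
  · rintro _ ⟨v, rfl⟩
    refine ⟨dChart p _ v, ?_⟩
    change mvfderiv (𝓡 n) f _ (dChartSymm p x _) = _
    rw [dChartSymm_dChart hx]
    rfl

end Charts

/-! ### Tensor fields with smooth coefficients -/

section Tensors

variable {n r : ℕ}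

theorem sum_smul_stdVec (v : E n) : ∑ k, v k • stdVec k = v := by
  ext i
  simp [stdVec, Finset.sum_apply, Pi.single_apply]

/-- A field of covariant tensors on an open set, with smooth coefficients. -/
structure IsSmoothTensorOn (U : Set (E n)) (T : E n → (Fin r → E n) → ℝ) : Prop where
  contDiffOn : ∀ w, ContDiffOn ℝ ∞ (fun x => T x w) U
  multilinear : ∀ x ∈ U, ∃ m : MultilinearMap ℝ (fun _ : Fin r => E n) ℝ, ∀ w, T x w = m w

variable {U V : Set (E n)} {T : E n → (Fin r → E n) → ℝ}

/-- Expanded in the standard basis, the value is a polynomial in the arguments whose coefficients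
are smooth in the point; hence joint smoothness. -/
theorem IsSmoothTensorOn.contDiffOn_uncurry (hT : IsSmoothTensorOn U T) :
    ContDiffOn ℝ ∞ (fun q : E n × (Fin r → E n) => T q.1 q.2) (U ×ˢ univ) := by
  have h : ContDiffOn ℝ ∞ (fun q : E n × (Fin r → E n) =>
      ∑ κ : Fin r → Fin n, (∏ s, (q.2 s) (κ s)) * T q.1 fun s => stdVec (κ s)) (U ×ˢ univ) := by
    refine ContDiffOn.sum fun κ _ => ContDiffOn.mul (ContDiff.contDiffOn ?_) ?_
    · refine contDiff_prod fun s _ => ?_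
      fun_prop
    · exact (hT.contDiffOn _).comp contDiff_fst.contDiffOn fun q hq => hq.1
  refine h.congr ?_
  rintro ⟨x, w⟩ hx
  obtain ⟨m, hm⟩ := hT.multilinear x hx.1
  simp only [hm]
  conv_lhs => rw [show w = fun s => ∑ k, (w s) k • stdVec k from
    funext fun s => (sum_smul_stdVec (w s)).symm]
  rw [MultilinearMap.map_sum]
  refine Finset.sum_congr rfl fun κ _ => ?_
  rw [MultilinearMap.map_smul_univ, smul_eq_mul]

theorem IsSmoothTensorOn.contDiffOn_comp (hT : IsSmoothTensorOn U T) {ψ : E n → E n}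
    {w : E n → Fin r → E n} (hψ : ContDiffOn ℝ ∞ ψ V) (hw : ∀ s, ContDiffOn ℝ ∞ (fun y => w y s) V)
    (hUV : MapsTo ψ V U) : ContDiffOn ℝ ∞ (fun y => T (ψ y) (w y)) V :=
  hT.contDiffOn_uncurry.comp (hψ.prodMk (contDiffOn_pi.2 hw)) fun _ hy => ⟨hUV hy, mem_univ _⟩

/-- The Leibniz rule for a tensor at a moving point with moving arguments: the differential on the
product splits into a point part and the linear derivative of a multilinear map. -/
theorem IsSmoothTensorOn.fderiv_comp (hT : IsSmoothTensorOn U T) (hU : IsOpen U)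
    {ψ : E n → E n} {w : E n → Fin r → E n} {x : E n} (hx : ψ x ∈ U)
    (hψ : DifferentiableAt ℝ ψ x) (hw : ∀ s, DifferentiableAt ℝ (fun y => w y s) x) (u : E n) :
    fderiv ℝ (fun y => T (ψ y) (w y)) x u =
      fderiv ℝ (fun y => T y (w x)) (ψ x) (fderiv ℝ ψ x u) +
        ∑ s, T (ψ x) (Function.update (w x) s (fderiv ℝ (fun y => w y s) x u)) := by
  set Q : E n × (Fin r → E n) → ℝ := fun q => T q.1 q.2
  have hQ : DifferentiableAt ℝ Q (ψ x, w x) :=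
    (hT.contDiffOn_uncurry.contDiffAt ((hU.prod isOpen_univ).mem_nhds
      ⟨hx, mem_univ _⟩)).differentiableAt (by simp)
  have hw' : HasFDerivAt w (ContinuousLinearMap.pi fun s => fderiv ℝ (fun y => w y s) x) x :=
    hasFDerivAt_pi.2 fun s => (hw s).hasFDerivAt
  have h1 := hQ.hasFDerivAt.comp x (hψ.hasFDerivAt.prodMk hw')
  have h2 := HasFDerivAt.comp (f := fun y => (y, w x)) (ψ x) hQ.hasFDerivAt
    ((hasFDerivAt_id (ψ x)).prodMk (hasFDerivAt_const (w x) (ψ x)))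
  have h3 := HasFDerivAt.comp (f := fun z => (ψ x, z)) (w x) hQ.hasFDerivAt
    ((hasFDerivAt_const (ψ x) (w x)).prodMk (hasFDerivAt_id (w x)))
  obtain ⟨m, hm⟩ := hT.multilinear _ hx
  let mc : ContinuousMultilinearMap ℝ (fun _ : Fin r => E n) ℝ := ⟨m, by
    have : Continuous fun w => T (ψ x) w := hT.contDiffOn_uncurry.continuousOn.comp_continuous
      (Continuous.prodMk_right (ψ x)) fun w => ⟨hx, mem_univ _⟩
    exact this.congr hm⟩
  have h4 : HasFDerivAt (fun w => T (ψ x) w) (mc.linearDeriv (w x)) (w x) := by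
    have := mc.hasFDerivAt (w x)
    refine this.congr_of_eventuallyEq (.of_forall fun z => ?_)
    exact hm z
  have e1 : fderiv ℝ (fun y => T (ψ y) (w y)) x = _ := h1.fderiv
  have e2 : fderiv ℝ (fun y => T y (w x)) (ψ x) = _ := h2.fderiv
  have e3 := h3.unique h4
  have e4 : (mc.linearDeriv (w x)) (fun s => fderiv ℝ (fun y => w y s) x u) =
      ∑ s, T (ψ x) (Function.update (w x) s (fderiv ℝ (fun y => w y s) x u)) := by
    rw [ContinuousMultilinearMap.linearDeriv_apply]
    exact Finset.sum_congr rfl fun s _ => (hm _).symm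
  rw [e1, e2, ← e4, ← e3]
  simp only [ContinuousLinearMap.comp_apply, ContinuousLinearMap.prod_apply]
  rw [← map_add]
  congr 1
  ext <;> simp

end Tensors

/-! ### Levi-Civita connection of a pullback metric -/

section Christoffel

variable {n : ℕ} {K : Type*} [NormedAddCommGroup K] [NormedSpace ℝ K]

/-- A kernel vector of the Gram matrix gives a vector orthogonal to the whole basis, hence to
itself. -/
theorem gram_det_ne_zero {b : E n →ₗ[ℝ] E n →ₗ[ℝ] ℝ} (hs : ∀ u v, b u v = b v u)
    (hb : ∀ u, b u u = 0 → u = 0) :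
    (Matrix.of fun k l => b (stdVec k) (stdVec l)).det ≠ 0 := by
  intro h0
  obtain ⟨v, hv, hAv⟩ := Matrix.exists_mulVec_eq_zero_iff.2 h0
  apply hv
  have hk : ∀ k, b (∑ l, v l • stdVec l) (stdVec k) = 0 := by
    intro k
    have := congrFun hAv k
    rw [Matrix.mulVec, dotProduct] at this
    rw [hs, map_sum, ← Pi.zero_apply (M := fun _ : Fin n => ℝ) k, ← this]
    refine Finset.sum_congr rfl fun l _ => ?_
    rw [map_smul, smul_eq_mul, mul_comm]; rfl
  have h1 : b (∑ l, v l • stdVec l) (∑ l, v l • stdVec l) = 0 := by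
    conv_lhs => rw [map_sum]
    exact Finset.sum_eq_zero fun k _ => by rw [map_smul, hk, smul_zero]
  have h2 := hb _ h1
  have h3 := sum_smul_stdVec (WithLp.toLp 2 v : E n)
  simp only at h3
  rw [h2] at h3
  funext i
  exact (congrArg (fun z : E n => z i) h3).symm

theorem sharp_spec {b : E n →ₗ[ℝ] E n →ₗ[ℝ] ℝ} (hs : ∀ u v, b u v = b v u)
    (hb : ∀ u, b u u = 0 → u = 0) (φ : E n →ₗ[ℝ] ℝ) (w : E n) :
    b (sharp (fun u v => b u v) φ) w = φ w := by
  set A : Matrix (Fin n) (Fin n) ℝ := Matrix.of fun k l => b (stdVec k) (stdVec l) with hA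
  have hdet : A.det ≠ 0 := gram_det_ne_zero hs hb
  have hAA : A * A⁻¹ = 1 := Matrix.mul_nonsing_inv A (isUnit_iff_ne_zero.2 hdet)
  have hj : ∀ j, b (sharp (fun u v => b u v) φ) (stdVec j) = φ (stdVec j) := by
    intro j
    have h1 : (A * A⁻¹).mulVec (fun l => φ (stdVec l)) j = φ (stdVec j) := by
      rw [hAA, Matrix.one_mulVec]
    rw [← Matrix.mulVec_mulVec, Matrix.mulVec, dotProduct] at h1
    rw [← h1, sharp, map_sum, LinearMap.sum_apply]
    refine Finset.sum_congr rfl fun k _ => ?_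
    rw [map_smul, LinearMap.smul_apply, smul_eq_mul, hs, mul_comm]
    rfl
  conv_lhs => rw [← sum_smul_stdVec w]
  conv_rhs => rw [← sum_smul_stdVec w]
  simp only [map_sum, map_smul, hj]

/-- `G` is on `U` the pullback under the immersion `H` of the symmetric bilinear form `B`. -/
structure IsPullbackMetric (B : K →L[ℝ] K →L[ℝ] ℝ) (H : E n → K) (U : Set (E n))
    (G : E n → E n → E n → ℝ) : Prop where
  isOpen : IsOpen U
  contDiffOn : ContDiffOn ℝ ∞ H U
  symm : ∀ a b, B a b = B b a
  nondeg : ∀ x ∈ U, ∀ u, B (fderiv ℝ H x u) (fderiv ℝ H x u) = 0 → u = 0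
  eq : ∀ x ∈ U, ∀ u v, G x u v = B (fderiv ℝ H x u) (fderiv ℝ H x v)

theorem contDiffOn_fderiv {U : Set (E n)} (hU : IsOpen U) {H : E n → K}
    (hH : ContDiffOn ℝ ∞ H U) : ContDiffOn ℝ ∞ (fderiv ℝ H) U :=
  hH.fderiv_of_isOpen hU (by simp)

/-- The second derivative. -/
def hess (H : E n → K) (x u v : E n) : K := fderiv ℝ (fderiv ℝ H) x u v

theorem hess_comm {U : Set (E n)} (hU : IsOpen U) {H : E n → K}
    (hH : ContDiffOn ℝ ∞ H U) {x : E n} (hx : x ∈ U) (u v : E n) :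
    hess H x u v = hess H x v u :=
  (((hH.contDiffAt (hU.mem_nhds hx)).isSymmSndFDerivAt
    (by simpa using WithTop.coe_le_coe.2 (le_top : (2 : ℕ∞) ≤ ⊤)))) u v

theorem fderiv_fderiv_apply {U : Set (E n)} (hU : IsOpen U) {H : E n → K}
    (hH : ContDiffOn ℝ ∞ H U) {x : E n} (hx : x ∈ U) (u v : E n) :
    fderiv ℝ (fun y => fderiv ℝ H y v) x u = hess H x u v := by
  have h : DifferentiableAt ℝ (fderiv ℝ H) x :=
    ((contDiffOn_fderiv hU hH).contDiffAt (hU.mem_nhds hx)).differentiableAt (by simp)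
  have := (h.hasFDerivAt.clm_apply (hasFDerivAt_const v x)).fderiv
  rw [this]
  simp [hess]

/-- The pullback of a bilinear form under a linear map. -/
def pullbackForm (B : K →L[ℝ] K →L[ℝ] ℝ) (L : E n →L[ℝ] K) : E n →ₗ[ℝ] E n →ₗ[ℝ] ℝ :=
  (B.bilinearComp L L).toBilinForm

namespace IsPullbackMetric

variable {B : K →L[ℝ] K →L[ℝ] ℝ} {H : E n → K} {U : Set (E n)} {G : E n → E n → E n → ℝ}

theorem fderiv_eq (h : IsPullbackMetric B H U G) {x : E n} (hx : x ∈ U) (u v w : E n) :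
    fderiv ℝ (fun y => G y v w) x u =
      B (hess H x u v) (fderiv ℝ H x w) + B (fderiv ℝ H x v) (hess H x u w) := by
  have hc := ((contDiffOn_fderiv h.isOpen h.contDiffOn).contDiffAt (h.isOpen.mem_nhds hx))
  have hd : ∀ v, DifferentiableAt ℝ (fun y => fderiv ℝ H y v) x := fun v =>
    (hc.differentiableAt (by simp)).clm_apply (differentiableAt_const v)
  have he : (fun y => G y v w) =ᶠ[nhds x] fun y => B (fderiv ℝ H y v) (fderiv ℝ H y w) := by
    filter_upwards [h.isOpen.mem_nhds hx] with y hy using h.eq y hy v w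
  rw [he.fderiv_eq, (B.hasFDerivAt_of_bilinear (hd v).hasFDerivAt (hd w).hasFDerivAt).fderiv]
  simp [ContinuousLinearMap.precompR_apply, ContinuousLinearMap.precompL_apply,
    fderiv_fderiv_apply h.isOpen h.contDiffOn hx, add_comm]

theorem contDiffOn_apply (h : IsPullbackMetric B H U G) (u v : E n) :
    ContDiffOn ℝ ∞ (fun x => G x u v) U := by
  have hd := contDiffOn_fderiv h.isOpen h.contDiffOn
  have : ContDiffOn ℝ ∞ (fun x => B (fderiv ℝ H x u) (fderiv ℝ H x v)) U :=
    (B.contDiff.comp_contDiffOn (hd.clm_apply contDiffOn_const)).clm_apply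
      (hd.clm_apply contDiffOn_const)
  exact this.congr fun x hx => h.eq x hx u v

theorem sharp_spec (h : IsPullbackMetric B H U G) {x : E n} (hx : x ∈ U) (φ : E n →ₗ[ℝ] ℝ)
    (w : E n) : B (fderiv ℝ H x (sharp (G x) φ)) (fderiv ℝ H x w) = φ w := by
  have hG : G x = fun u v => pullbackForm B (fderiv ℝ H x) u v := by
    funext u v
    exact h.eq x hx u v
  rw [hG]
  exact Isoparametric.sharp_spec (b := pullbackForm B (fderiv ℝ H x)) (fun _ _ => h.symm _ _)
    (h.nondeg x hx) φ w

/-- The Christoffel symbols are the tangential part of the second derivative. -/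
theorem christoffel_spec (h : IsPullbackMetric B H U G) {x : E n} (hx : x ∈ U) (u v w : E n) :
    B (fderiv ℝ H x (christoffel G x u v)) (fderiv ℝ H x w) =
      B (hess H x u v) (fderiv ℝ H x w) := by
  let φ : E n →ₗ[ℝ] ℝ := ((B (hess H x u v)).comp (fderiv ℝ H x)).toLinearMap
  have hφ : (fun w => (1 / 2 : ℝ) * (fderiv ℝ (fun y => G y v w) x u
      + fderiv ℝ (fun y => G y u w) x v - fderiv ℝ (fun y => G y u v) x w)) = φ := by
    funext w
    have hφ : φ w = B (hess H x u v) (fderiv ℝ H x w) := rfl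
    rw [h.fderiv_eq hx, h.fderiv_eq hx, h.fderiv_eq hx, hφ,
      hess_comm h.isOpen h.contDiffOn hx v u, hess_comm h.isOpen h.contDiffOn hx w u,
      hess_comm h.isOpen h.contDiffOn hx w v, h.symm (hess H x u w)]
    ring
  rw [christoffel, hφ]
  exact h.sharp_spec hx φ w

/-- The standard test for equality of coordinate vectors below: push forward by the differential of
`H` and pair with tangent vectors. -/
theorem eq_of_forall (h : IsPullbackMetric B H U G) {x : E n} (hx : x ∈ U) {u v : E n}
    (huv : ∀ w, B (fderiv ℝ H x u) (fderiv ℝ H x w) = B (fderiv ℝ H x v) (fderiv ℝ H x w)) :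
    u = v := by
  rw [← sub_eq_zero]
  refine h.nondeg x hx _ ?_
  simp only [map_sub, sub_apply] at huv ⊢
  rw [huv, huv]
  ring

/-- The defining property `christoffel_spec` has a right side bilinear in `u`, `v`, and
nondegeneracy transfers this to the symbols. -/
theorem christoffel_linear (h : IsPullbackMetric B H U G) {x : E n} (hx : x ∈ U) :
    ∃ L : E n →ₗ[ℝ] E n →ₗ[ℝ] E n, ∀ u v, christoffel G x u v = L u v := by
  refine ⟨LinearMap.mk₂ ℝ (christoffel G x) ?_ ?_ ?_ ?_, fun u v => rfl⟩ <;>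
  · intros
    refine h.eq_of_forall hx fun w => ?_
    simp [h.christoffel_spec hx, hess]

theorem contDiffOn_det {m : ℕ} {A : E n → Matrix (Fin m) (Fin m) ℝ}
    (hA : ∀ i j, ContDiffOn ℝ ∞ (fun x => A x i j) U) :
    ContDiffOn ℝ ∞ (fun x => (A x).det) U := by
  simp only [Matrix.det_apply]
  exact ContDiffOn.sum fun σ _ => (contDiffOn_prod fun i _ => hA _ _).const_smul _

theorem contDiffOn_sharp (h : IsPullbackMetric B H U G) {φ : E n → E n → ℝ}
    (hφ : ∀ w, ContDiffOn ℝ ∞ (fun x => φ x w) U) :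
    ContDiffOn ℝ ∞ (fun x => sharp (G x) (φ x)) U := by
  set A : E n → Matrix (Fin n) (Fin n) ℝ :=
    fun x => Matrix.of fun a b => G x (stdVec a) (stdVec b) with hA
  have hAc : ∀ i j, ContDiffOn ℝ ∞ (fun x => A x i j) U := fun i j => h.contDiffOn_apply _ _
  have hdet : ∀ x ∈ U, (A x).det ≠ 0 := by
    intro x hx
    have hAx : A x = Matrix.of fun k l =>
        pullbackForm B (fderiv ℝ H x) (stdVec k) (stdVec l) := by
      ext k l
      exact h.eq x hx _ _
    rw [hAx]
    exact gram_det_ne_zero (fun _ _ => h.symm _ _) (h.nondeg x hx)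
  have hinv : ∀ k l, ContDiffOn ℝ ∞ (fun x => (A x)⁻¹ k l) U := by
    intro k l
    have : ContDiffOn ℝ ∞ (fun x => (A x).det⁻¹ *
        ((A x).updateRow l (Pi.single k 1)).det) U := by
      refine ((contDiffOn_det hAc).inv hdet).mul (contDiffOn_det fun i j => ?_)
      by_cases hi : i = l
      · subst hi
        simp only [Matrix.updateRow_self]
        exact contDiffOn_const
      · simp only [Matrix.updateRow_ne hi]
        exact hAc i j
    refine this.congr fun x _ => ?_
    rw [Matrix.inv_def, Ring.inverse_eq_inv', Matrix.smul_apply, Matrix.adjugate_apply, smul_eq_mul]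
  unfold sharp
  exact ContDiffOn.sum fun k _ => ContDiffOn.smul_const
    (ContDiffOn.sum fun l _ => (hinv k l).mul (hφ _)) _

theorem contDiffOn_christoffel (h : IsPullbackMetric B H U G) (u v : E n) :
    ContDiffOn ℝ ∞ (fun x => christoffel G x u v) U := by
  have hG : ∀ a b c, ContDiffOn ℝ ∞ (fun x => fderiv ℝ (fun y => G y a b) x c) U := fun a b c =>
    (((h.contDiffOn_apply a b).fderiv_of_isOpen h.isOpen (by simp)).clm_apply contDiffOn_const)
  exact h.contDiffOn_sharp fun w =>
    contDiffOn_const.mul (((hG _ _ _).add (hG _ _ _)).sub (hG _ _ _))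

/-- Christoffel symbols of isometric metrics. -/
theorem fderiv_christoffel (h : IsPullbackMetric B H U G) {H' : E n → K} {V : Set (E n)}
    {G' : E n → E n → E n → ℝ} (h' : IsPullbackMetric B H' V G') {R : K →L[ℝ] K}
    (hR : ∀ a b, B (R a) (R b) = B a b) {W : Set (E n)} (hW : IsOpen W) {ψ : E n → E n}
    (hψ : ContDiffOn ℝ ∞ ψ W) (hWU : W ⊆ U) (hψV : MapsTo ψ W V)
    (hH : ∀ x ∈ W, H' (ψ x) = R (H x)) {x : E n} (hx : x ∈ W)
    (hsurj : Function.Surjective (fderiv ℝ ψ x)) (u v : E n) :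
    fderiv ℝ ψ x (christoffel G x u v) =
      christoffel G' (ψ x) (fderiv ℝ ψ x u) (fderiv ℝ ψ x v) + hess ψ x u v := by
  have hψd : ∀ y ∈ W, DifferentiableAt ℝ ψ y := fun y hy =>
    (hψ.contDiffAt (hW.mem_nhds hy)).differentiableAt (by simp)
  have hHd : ∀ y ∈ W, DifferentiableAt ℝ H y := fun y hy =>
    (h.contDiffOn.contDiffAt (h.isOpen.mem_nhds (hWU hy))).differentiableAt (by simp)
  have hHd' : ∀ y ∈ W, DifferentiableAt ℝ H' (ψ y) := fun y hy =>
    (h'.contDiffOn.contDiffAt (h'.isOpen.mem_nhds (hψV hy))).differentiableAt (by simp)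
  -- Differentiating H' ∘ ψ = R ∘ H once gives the relation of tangent vectors; differentiating it
  -- again gives `hR2`.
  have h1 : ∀ y ∈ W, (fderiv ℝ H' (ψ y)).comp (fderiv ℝ ψ y) = R.comp (fderiv ℝ H y) := by
    intro y hy
    rw [← fderiv_comp y (hHd' y hy) (hψd y hy), ← (R.hasFDerivAt.comp y (hHd y hy).hasFDerivAt).fderiv]
    refine Filter.EventuallyEq.fderiv_eq ?_
    filter_upwards [hW.mem_nhds hy] with z hz using hH z hz
  have hR1 : ∀ y ∈ W, ∀ w, R (fderiv ℝ H y w) = fderiv ℝ H' (ψ y) (fderiv ℝ ψ y w) := fun y hy w =>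
    (congrArg (fun L => L w) (h1 y hy)).symm
  have hR2 : R (hess H x u v) = hess H' (ψ x) (fderiv ℝ ψ x u) (fderiv ℝ ψ x v)
      + fderiv ℝ H' (ψ x) (hess ψ x u v) := by
    have e : (fun y => R (fderiv ℝ H y v)) =ᶠ[nhds x]
        fun y => fderiv ℝ H' (ψ y) (fderiv ℝ ψ y v) := by
      filter_upwards [hW.mem_nhds hx] with y hy using hR1 y hy v
    have d1 : DifferentiableAt ℝ (fderiv ℝ H) x := ((contDiffOn_fderiv h.isOpen
      h.contDiffOn).contDiffAt (h.isOpen.mem_nhds (hWU hx))).differentiableAt (by simp)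
    have d2 : DifferentiableAt ℝ (fderiv ℝ H') (ψ x) := ((contDiffOn_fderiv h'.isOpen
      h'.contDiffOn).contDiffAt (h'.isOpen.mem_nhds (hψV hx))).differentiableAt (by simp)
    have d3 : DifferentiableAt ℝ (fderiv ℝ ψ) x := ((contDiffOn_fderiv hW
      hψ).contDiffAt (hW.mem_nhds hx)).differentiableAt (by simp)
    have e1 := (R.hasFDerivAt.comp x
      (d1.hasFDerivAt.clm_apply (hasFDerivAt_const v x))).fderiv
    have e2 := ((d2.hasFDerivAt.comp x (hψd x hx).hasFDerivAt).clm_apply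
      (d3.hasFDerivAt.clm_apply (hasFDerivAt_const v x))).fderiv
    have e3 := congrArg (fun L => L u) (e1.symm.trans (e.fderiv_eq.trans e2))
    simp only [ContinuousLinearMap.comp_apply] at e3
    simpa [hess, add_comm] using e3
  -- Because dψ is surjective, test vectors of the form dψ(w) suffice. Pairing `hR2` with them and
  -- removing the isometry R leaves the defining property of the first Christoffel symbol.
  refine h'.eq_of_forall (hψV hx) fun w => ?_
  obtain ⟨w, rfl⟩ := hsurj w
  rw [← hR1 x hx, ← hR1 x hx, hR, h.christoffel_spec (hWU hx), ← hR, hR2, hR1 x hx]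
  simp only [map_add, add_apply, h'.christoffel_spec (hψV hx)]

theorem isSmoothTensorOn_covDeriv (h : IsPullbackMetric B H U G) {r : ℕ}
    {T : E n → (Fin r → E n) → ℝ} (hT : IsSmoothTensorOn U T) :
    IsSmoothTensorOn U (covDeriv G T) := by
  constructor
  · intro w
    refine ContDiffOn.sub ?_ (ContDiffOn.sum fun s _ => ?_)
    · exact ((hT.contDiffOn _).fderiv_of_isOpen h.isOpen (by simp)).clm_apply contDiffOn_const
    · refine hT.contDiffOn_comp contDiffOn_id (fun s' => ?_) (mapsTo_id U)
      by_cases hs : s' = s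
      · subst hs
        simpa using h.contDiffOn_christoffel _ _
      · simpa [hs] using contDiffOn_const
  · intro x hx
    obtain ⟨m, hm⟩ := hT.multilinear x hx
    obtain ⟨L, hL⟩ := h.christoffel_linear hx
    have hnx := h.isOpen.mem_nhds hx
    have hd : ∀ v, DifferentiableAt ℝ (fun y => T y v) x := fun v =>
      ((hT.contDiffOn v).contDiffAt hnx).differentiableAt (by simp)
    -- The two parts of ∇T as linear maps from the direction of differentiation to multilinear maps:
    -- `f₁` is the partial derivative, `f₂` the Christoffel correction. Uncurrying on the left puts
    -- the direction in the first slot.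
    let f₁ : E n →ₗ[ℝ] MultilinearMap ℝ (fun _ : Fin r => E n) ℝ :=
      { toFun := fun u =>
          { toFun := fun v => fderiv ℝ (fun y => T y v) x u
            map_update_add' := by
              intro inst v i a b
              obtain rfl : inst = instDecidableEqFin r := Subsingleton.elim _ _
              have : (fun y => T y (Function.update v i (a + b))) =ᶠ[nhds x]
                  fun y => T y (Function.update v i a) + T y (Function.update v i b) := by
                filter_upwards [hnx] with y hy
                obtain ⟨m, hm⟩ := hT.multilinear y hy
                simp only [hm, m.map_update_add]
              rw [this.fderiv_eq, fderiv_fun_add (hd _) (hd _), add_apply]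
            map_update_smul' := by
              intro inst v i c a
              obtain rfl : inst = instDecidableEqFin r := Subsingleton.elim _ _
              have : (fun y => T y (Function.update v i (c • a))) =ᶠ[nhds x]
                  fun y => c • T y (Function.update v i a) := by
                filter_upwards [hnx] with y hy
                obtain ⟨m, hm⟩ := hT.multilinear y hy
                simp only [hm, m.map_update_smul]
              rw [this.fderiv_eq, fderiv_fun_const_smul (hd _), smul_apply] }
        map_add' := fun u u' => by ext v; exact map_add (fderiv ℝ (fun y => T y v) x) u u'
        map_smul' := fun c u => by ext v; exact map_smul (fderiv ℝ (fun y => T y v) x) c u }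
    -- Updating one argument by a linear image of itself is a composition with linear maps slot by
    -- slot, so `compLinearMap` applies.
    have hupd : ∀ (A : E n →ₗ[ℝ] E n) (s : Fin r) (v : Fin r → E n),
        (fun s' => (if s' = s then A else LinearMap.id) (v s')) = Function.update v s (A (v s)) := by
      intro A s v
      funext s'
      by_cases hs : s' = s
      · subst hs; simp
      · simp [hs]
    let f₂ : E n →ₗ[ℝ] MultilinearMap ℝ (fun _ : Fin r => E n) ℝ :=
      ∑ s, { toFun := fun u => m.compLinearMap fun s' => if s' = s then L u else LinearMap.id
             map_add' := fun u u' => by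
              ext v
              simp only [MultilinearMap.compLinearMap_apply, add_apply, hupd,
                map_add, LinearMap.add_apply, m.map_update_add]
             map_smul' := fun c u => by
              ext v
              simp only [MultilinearMap.compLinearMap_apply, smul_apply, hupd,
                map_smul, LinearMap.smul_apply, m.map_update_smul, RingHom.id_apply] }
    refine ⟨(f₁ - f₂).uncurryLeft, fun w => ?_⟩
    rw [LinearMap.uncurryLeft_apply, LinearMap.sub_apply, sub_apply,
      LinearMap.sum_apply, sum_apply]
    refine congrArg₂ (· - ·) rfl (Finset.sum_congr rfl fun s _ => ?_)
    change _ = m.compLinearMap _ _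
    rw [MultilinearMap.compLinearMap_apply, hupd, hm, hL]

/-- Naturality of the covariant derivative of tensor fields. -/
theorem covDeriv_comp (h' : IsPullbackMetric B H U G) {r : ℕ}
    {T S : E n → (Fin r → E n) → ℝ} {G₁ : E n → E n → E n → ℝ} (hT : IsSmoothTensorOn U T)
    {W : Set (E n)} (hW : IsOpen W) {ψ : E n → E n} (hψ : ContDiffOn ℝ ∞ ψ W)
    (hψU : MapsTo ψ W U) {ε : ℝ}
    (hS : ∀ x ∈ W, ∀ w, S x w = ε * T (ψ x) fun s => fderiv ℝ ψ x (w s))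
    (hΓ : ∀ x ∈ W, ∀ u v, fderiv ℝ ψ x (christoffel G₁ x u v) =
      christoffel G (ψ x) (fderiv ℝ ψ x u) (fderiv ℝ ψ x v) + hess ψ x u v)
    {x : E n} (hx : x ∈ W) (w : Fin (r + 1) → E n) :
    covDeriv G₁ S x w = ε * covDeriv G T (ψ x) fun s => fderiv ℝ ψ x (w s) := by
  have hnx := hW.mem_nhds hx
  have hψd : DifferentiableAt ℝ ψ x := (hψ.contDiffAt hnx).differentiableAt (by simp)
  have hψd2 : ∀ v, DifferentiableAt ℝ (fun y => fderiv ℝ ψ y v) x := fun v =>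
    (((contDiffOn_fderiv hW hψ).contDiffAt hnx).differentiableAt (by simp)).clm_apply
      (differentiableAt_const v)
  set v := Fin.tail w with hv
  have e1 : (fun y => S y v) =ᶠ[nhds x] fun y => ε * T (ψ y) fun s => fderiv ℝ ψ y (v s) := by
    filter_upwards [hnx] with y hy using hS y hy v
  have e2 : DifferentiableAt ℝ (fun y => T (ψ y) fun s => fderiv ℝ ψ y (v s)) x :=
    ((hT.contDiffOn_comp (w := fun y s => fderiv ℝ ψ y (v s)) hψ (fun s =>
      (contDiffOn_fderiv hW hψ).clm_apply contDiffOn_const) hψU).contDiffAt hnx).differentiableAt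
        (by simp)
  have e3 := hT.fderiv_comp (w := fun y s => fderiv ℝ ψ y (v s)) h'.isOpen (hψU hx) hψd
    (fun s => hψd2 (v s)) (w 0)
  obtain ⟨m, hm⟩ := hT.multilinear _ (hψU hx)
  have htail : (Fin.tail fun s => fderiv ℝ ψ x (w s)) = fun s => fderiv ℝ ψ x (v s) := rfl
  rw [covDeriv, covDeriv, htail, ← hv, e1.fderiv_eq, fderiv_const_mul e2, smul_apply, smul_eq_mul,
    e3, mul_sub, mul_add, add_sub_assoc, sub_eq_add_neg]
  congr 1
  -- The Christoffel term in slot `s` splits into the transported symbol and a second derivative of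
  -- ψ. The latter cancels the term that `e3` gets by differentiating the argument dψ(v s).
  have e4 : ∀ s, S x (Function.update v s (christoffel G₁ x (w 0) (v s))) =
      ε * T (ψ x) (Function.update (fun s => fderiv ℝ ψ x (v s)) s
        (christoffel G (ψ x) (fderiv ℝ ψ x (w 0)) (fderiv ℝ ψ x (v s)))) +
      ε * T (ψ x) (Function.update (fun s => fderiv ℝ ψ x (v s)) s
        (fderiv ℝ (fun y => fderiv ℝ ψ y (v s)) x (w 0))) := by
    intro s
    have : (fun s' => fderiv ℝ ψ x (Function.update v s (christoffel G₁ x (w 0) (v s)) s')) =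
        Function.update (fun s => fderiv ℝ ψ x (v s)) s
        (christoffel G (ψ x) (fderiv ℝ ψ x (w 0)) (fderiv ℝ ψ x (v s)) +
          hess ψ x (w 0) (v s)) := by
      funext s'
      by_cases hs : s' = s
      · subst hs
        simp [hΓ x hx]
      · simp [hs]
    rw [hS x hx, this, hm, m.map_update_add, ← hm, ← hm, fderiv_fderiv_apply hW hψ hx, mul_add]
  rw [Finset.sum_congr rfl fun s _ => e4 s, Finset.sum_add_distrib, ← Finset.mul_sum,
    ← Finset.mul_sum]
  ring_nf

end IsPullbackMetric
end Christoffel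

/-! ### Legendrian immersions and their cubic form -/

section Legendre

variable {n : ℕ} {K : Type*} [NormedAddCommGroup K] [InnerProductSpace ℝ K]

/-- A Legendrian immersion `(f, e)` of an open subset of `ℝⁿ` into the unit tangent bundle of
the sphere. -/
structure IsLegendrianOn (U : Set (E n)) (f e : E n → K) : Prop where
  isOpen : IsOpen U
  contDiffOn_fst : ContDiffOn ℝ ∞ f U
  contDiffOn_snd : ContDiffOn ℝ ∞ e U
  inner_fst_fst : ∀ x ∈ U, ⟪f x, f x⟫ = 1
  inner_snd_snd : ∀ x ∈ U, ⟪e x, e x⟫ = 1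
  inner_snd_fst : ∀ x ∈ U, ⟪e x, f x⟫ = 0
  inner_snd_fderiv_fst : ∀ x ∈ U, ∀ u, ⟪e x, fderiv ℝ f x u⟫ = 0
  eq_zero : ∀ x ∈ U, ∀ u, fderiv ℝ f x u = 0 → fderiv ℝ e x u = 0 → u = 0

theorem fderiv_inner_of_eq_const {U : Set (E n)} (hU : IsOpen U) {a b : E n → K} {c : ℝ}
    (ha : ContDiffOn ℝ ∞ a U) (hb : ContDiffOn ℝ ∞ b U) (h : ∀ x ∈ U, ⟪a x, b x⟫ = c) {x : E n}
    (hx : x ∈ U) (u : E n) : ⟪a x, fderiv ℝ b x u⟫ + ⟪fderiv ℝ a x u, b x⟫ = 0 := by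
  have hn := hU.mem_nhds hx
  have e1 : (fun y => ⟪a y, b y⟫) =ᶠ[nhds x] fun _ => c := by
    filter_upwards [hn] with y hy using h y hy
  rw [← fderiv_inner_apply ℝ ((ha.contDiffAt hn).differentiableAt (by simp))
    ((hb.contDiffAt hn).differentiableAt (by simp)), e1.fderiv_eq]
  simp

namespace IsLegendrianOn

variable {U : Set (E n)} {f e : E n → K}

theorem inner_fst_fderiv_fst (h : IsLegendrianOn U f e) {x : E n} (hx : x ∈ U) (u : E n) :
    ⟪f x, fderiv ℝ f x u⟫ = 0 := by
  have := fderiv_inner_of_eq_const h.isOpen h.contDiffOn_fst h.contDiffOn_fst h.inner_fst_fst hx u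
  rw [real_inner_comm (f x)] at this
  linarith

theorem inner_snd_fderiv_snd (h : IsLegendrianOn U f e) {x : E n} (hx : x ∈ U) (u : E n) :
    ⟪e x, fderiv ℝ e x u⟫ = 0 := by
  have := fderiv_inner_of_eq_const h.isOpen h.contDiffOn_snd h.contDiffOn_snd h.inner_snd_snd hx u
  rw [real_inner_comm (e x)] at this
  linarith

theorem inner_fst_fderiv_snd (h : IsLegendrianOn U f e) {x : E n} (hx : x ∈ U) (u : E n) :
    ⟪f x, fderiv ℝ e x u⟫ = 0 := by
  have := fderiv_inner_of_eq_const h.isOpen h.contDiffOn_snd h.contDiffOn_fst h.inner_snd_fst hx u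
  rw [h.inner_snd_fderiv_fst x hx, real_inner_comm] at this
  linarith

/-- Differentiating ⟨e, df(v)⟩ = 0 gives ⟨de(u), df(v)⟩ = -⟨e, D²f(u, v)⟩, which is symmetric. This
is the symmetry of the second fundamental form, and it needs no immersion `f`. -/
theorem inner_fderiv_comm (h : IsLegendrianOn U f e) {x : E n} (hx : x ∈ U) (u v : E n) :
    ⟪fderiv ℝ e x u, fderiv ℝ f x v⟫ = ⟪fderiv ℝ e x v, fderiv ℝ f x u⟫ := by
  have hd := contDiffOn_fderiv h.isOpen h.contDiffOn_fst
  have key : ∀ u v, ⟪e x, hess f x u v⟫ + ⟪fderiv ℝ e x u, fderiv ℝ f x v⟫ = 0 := by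
    intro u v
    rw [← fderiv_fderiv_apply h.isOpen h.contDiffOn_fst hx]
    exact fderiv_inner_of_eq_const (b := fun y => fderiv ℝ f y v) h.isOpen h.contDiffOn_snd
      (hd.clm_apply contDiffOn_const) (fun y hy => h.inner_snd_fderiv_fst y hy v) hx u
  have h1 := key u v
  have h2 := key v u
  rw [hess_comm h.isOpen h.contDiffOn_fst hx] at h2
  linarith

/-- The cubic form of a Legendrian immersion. -/
def _root_.Isoparametric.cubicForm (f e : E n → K) (x : E n) (w : Fin 3 → E n) : ℝ :=
  ⟪hess f x (w 0) (w 1), fderiv ℝ e x (w 2)⟫ - ⟪hess e x (w 0) (w 1), fderiv ℝ f x (w 2)⟫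

theorem differentiableAt (h : IsLegendrianOn U f e) {x : E n} (hx : x ∈ U) :
    DifferentiableAt ℝ f x ∧ DifferentiableAt ℝ e x :=
  ⟨(h.contDiffOn_fst.contDiffAt (h.isOpen.mem_nhds hx)).differentiableAt (by simp),
    (h.contDiffOn_snd.contDiffAt (h.isOpen.mem_nhds hx)).differentiableAt (by simp)⟩

theorem isSmoothTensorOn_cubicForm (h : IsLegendrianOn U f e) :
    IsSmoothTensorOn U (cubicForm f e) := by
  have hf := contDiffOn_fderiv h.isOpen h.contDiffOn_fst
  have he := contDiffOn_fderiv h.isOpen h.contDiffOn_snd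
  have hf2 : ∀ u v, ContDiffOn ℝ ∞ (fun x => hess f x u v) U := fun u v =>
    ((hf.fderiv_of_isOpen h.isOpen (by simp)).clm_apply contDiffOn_const).clm_apply
      contDiffOn_const
  have he2 : ∀ u v, ContDiffOn ℝ ∞ (fun x => hess e x u v) U := fun u v =>
    ((he.fderiv_of_isOpen h.isOpen (by simp)).clm_apply contDiffOn_const).clm_apply
      contDiffOn_const
  constructor
  · intro w
    exact ((hf2 _ _).inner ℝ (he.clm_apply contDiffOn_const)).sub
      ((he2 _ _).inner ℝ (hf.clm_apply contDiffOn_const))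
  · intro x _
    refine ⟨{ toFun := cubicForm f e x, map_update_add' := ?_, map_update_smul' := ?_ },
      fun w => rfl⟩
    · intro inst w i a b
      obtain rfl : inst = instDecidableEqFin 3 := Subsingleton.elim _ _
      fin_cases i <;>
        simp [cubicForm, hess, inner_add_left, inner_add_right] <;> ring
    · intro inst w i c a
      obtain rfl : inst = instDecidableEqFin 3 := Subsingleton.elim _ _
      fin_cases i <;>
        simp [cubicForm, hess, inner_smul_left, inner_smul_right] <;> ring

theorem hess_comp {U W : Set (E n)} (hU : IsOpen U) (hW : IsOpen W) {f : E n → K} {ψ : E n → E n}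
    (hf : ContDiffOn ℝ ∞ f U) (hψ : ContDiffOn ℝ ∞ ψ W) (hψU : MapsTo ψ W U) {x : E n} (hx : x ∈ W)
    (u v : E n) :
    hess (f ∘ ψ) x u v =
      hess f (ψ x) (fderiv ℝ ψ x u) (fderiv ℝ ψ x v) + fderiv ℝ f (ψ x) (hess ψ x u v) := by
  have hψd : ∀ y ∈ W, DifferentiableAt ℝ ψ y := fun y hy =>
    (hψ.contDiffAt (hW.mem_nhds hy)).differentiableAt (by simp)
  have hfd : ∀ y ∈ W, DifferentiableAt ℝ f (ψ y) := fun y hy =>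
    (hf.contDiffAt (hU.mem_nhds (hψU hy))).differentiableAt (by simp)
  have e : (fun y => fderiv ℝ (f ∘ ψ) y v) =ᶠ[nhds x]
      fun y => fderiv ℝ f (ψ y) (fderiv ℝ ψ y v) := by
    filter_upwards [hW.mem_nhds hx] with y hy
    rw [fderiv_comp y (hfd y hy) (hψd y hy)]
    rfl
  have d2 : DifferentiableAt ℝ (fderiv ℝ f) (ψ x) := ((contDiffOn_fderiv hU
    hf).contDiffAt (hU.mem_nhds (hψU hx))).differentiableAt (by simp)
  have d3 : DifferentiableAt ℝ (fderiv ℝ ψ) x := ((contDiffOn_fderiv hW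
    hψ).contDiffAt (hW.mem_nhds hx)).differentiableAt (by simp)
  have e2 := ((d2.hasFDerivAt.comp x (hψd x hx).hasFDerivAt).clm_apply
    (d3.hasFDerivAt.clm_apply (hasFDerivAt_const v x))).fderiv
  rw [← fderiv_fderiv_apply hW (hf.comp hψ hψU) hx]
  have e3 := congrArg (fun L => L u) (e.fderiv_eq.trans e2)
  simpa [hess, add_comm] using e3

theorem fderiv_linearComb {f e : E n → K} {x : E n} (hf : DifferentiableAt ℝ f x)
    (he : DifferentiableAt ℝ e x) (a b : ℝ) (u : E n) :
    fderiv ℝ (fun y => a • f y + b • e y) x u = a • fderiv ℝ f x u + b • fderiv ℝ e x u := by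
  have : fderiv ℝ (fun y => a • f y + b • e y) x = a • fderiv ℝ f x + b • fderiv ℝ e x :=
    ((hf.hasFDerivAt.const_smul a).add (he.hasFDerivAt.const_smul b)).fderiv
  rw [this]
  rfl

theorem hess_linearComb {U : Set (E n)} (hU : IsOpen U) {f e : E n → K} (hf : ContDiffOn ℝ ∞ f U)
    (he : ContDiffOn ℝ ∞ e U) (a b : ℝ) {x : E n} (hx : x ∈ U) (u v : E n) :
    hess (fun y => a • f y + b • e y) x u v = a • hess f x u v + b • hess e x u v := by
  have hd : ∀ {g : E n → K}, ContDiffOn ℝ ∞ g U → ∀ y ∈ U, DifferentiableAt ℝ g y := fun hg y hy =>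
    (hg.contDiffAt (hU.mem_nhds hy)).differentiableAt (by simp)
  have hd2 : ∀ {g : E n → K}, ContDiffOn ℝ ∞ g U → DifferentiableAt ℝ (fderiv ℝ g) x := fun hg =>
    ((contDiffOn_fderiv hU hg).contDiffAt (hU.mem_nhds hx)).differentiableAt (by simp)
  have e1 : fderiv ℝ (fun y => a • f y + b • e y) =ᶠ[nhds x]
      fun y => a • fderiv ℝ f y + b • fderiv ℝ e y := by
    filter_upwards [hU.mem_nhds hx] with y hy
    exact (((hd hf y hy).hasFDerivAt.const_smul a).add
      ((hd he y hy).hasFDerivAt.const_smul b)).fderiv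
  have e2 : fderiv ℝ (fun y => a • fderiv ℝ f y + b • fderiv ℝ e y) x =
      a • fderiv ℝ (fderiv ℝ f) x + b • fderiv ℝ (fderiv ℝ e) x :=
    (((hd2 hf).hasFDerivAt.const_smul a).add ((hd2 he).hasFDerivAt.const_smul b)).fderiv
  rw [hess, e1.fderiv_eq, e2]
  rfl

/-- The cubic form changes its sign under the composition of a change of coordinates with a
reflection of the plane spanned by the position vector and the normal vector. -/
theorem cubicForm_reflection {f' e' : E n → K} {V W : Set (E n)} (h : IsLegendrianOn U f e)
    (h' : IsLegendrianOn V f' e') (hW : IsOpen W) {ψ : E n → E n} (hψ : ContDiffOn ℝ ∞ ψ W)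
    (hWU : W ⊆ U) (hψV : MapsTo ψ W V) {c s : ℝ} (hcs : c ^ 2 + s ^ 2 = 1)
    (hf : ∀ x ∈ W, f' (ψ x) = c • f x + s • e x) (he : ∀ x ∈ W, e' (ψ x) = s • f x + (-c) • e x)
    {x : E n} (hx : x ∈ W) (w : Fin 3 → E n) :
    cubicForm f e x w = -cubicForm f' e' (ψ x) fun i => fderiv ℝ ψ x (w i) := by
  have hψd : DifferentiableAt ℝ ψ x := (hψ.contDiffAt (hW.mem_nhds hx)).differentiableAt (by simp)
  have hfW := h.contDiffOn_fst.mono hWU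
  have heW := h.contDiffOn_snd.mono hWU
  obtain ⟨df, de⟩ := h.differentiableAt (hWU hx)
  obtain ⟨df', de'⟩ := h'.differentiableAt (hψV hx)
  have ev1 : (f' ∘ ψ) =ᶠ[nhds x] fun x => c • f x + s • e x := by
    filter_upwards [hW.mem_nhds hx] with y hy using hf y hy
  have ev2 : (e' ∘ ψ) =ᶠ[nhds x] fun x => s • f x + (-c) • e x := by
    filter_upwards [hW.mem_nhds hx] with y hy using he y hy
  have d1 : ∀ u, fderiv ℝ f' (ψ x) (fderiv ℝ ψ x u) = c • fderiv ℝ f x u + s • fderiv ℝ e x u := by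
    intro u
    have := ev1.fderiv_eq (𝕜 := ℝ)
    rw [fderiv_comp x df' hψd] at this
    rw [← fderiv_linearComb df de, ← this]
    rfl
  have d2 : ∀ u, fderiv ℝ e' (ψ x) (fderiv ℝ ψ x u) =
      s • fderiv ℝ f x u + (-c) • fderiv ℝ e x u := by
    intro u
    have := ev2.fderiv_eq (𝕜 := ℝ)
    rw [fderiv_comp x de' hψd] at this
    rw [← fderiv_linearComb df de, ← this]
    rfl
  have s1 : ∀ u v, hess f' (ψ x) (fderiv ℝ ψ x u) (fderiv ℝ ψ x v) =
      c • hess f x u v + s • hess e x u v - fderiv ℝ f' (ψ x) (hess ψ x u v) := by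
    intro u v
    rw [← hess_linearComb hW hfW heW c s hx, eq_sub_iff_add_eq,
      ← hess_comp h'.isOpen hW h'.contDiffOn_fst hψ hψV hx]
    unfold hess
    rw [(ev1.fderiv (𝕜 := ℝ)).fderiv_eq]
  have s2 : ∀ u v, hess e' (ψ x) (fderiv ℝ ψ x u) (fderiv ℝ ψ x v) =
      s • hess f x u v + (-c) • hess e x u v - fderiv ℝ e' (ψ x) (hess ψ x u v) := by
    intro u v
    rw [← hess_linearComb hW hfW heW s (-c) hx, eq_sub_iff_add_eq,
      ← hess_comp h'.isOpen hW h'.contDiffOn_snd hψ hψV hx]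
    unfold hess
    rw [(ev2.fderiv (𝕜 := ℝ)).fderiv_eq]
  -- The second derivative of ψ enters as ⟨df'(D²ψ), de'⟩ - ⟨de'(D²ψ), df'⟩, which vanishes by this
  -- symmetry.
  have hsy := h'.inner_fderiv_comm (hψV hx) (hess ψ x (w 0) (w 1)) (fderiv ℝ ψ x (w 2))
  rw [real_inner_comm (fderiv ℝ f' (ψ x) (hess ψ x (w 0) (w 1)))] at hsy
  simp only [cubicForm, s1, s2, inner_sub_left]
  rw [hsy]
  simp only [d1, d2, inner_add_left, inner_add_right, inner_smul_left, inner_smul_right]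
  simp
  -- What is left is the alternating form in (f, e) times the determinant -(c² + s²).
  linear_combination (-(⟪hess f x (w 0) (w 1), fderiv ℝ e x (w 2)⟫) +
    ⟪hess e x (w 0) (w 1), fderiv ℝ f x (w 2)⟫) * hcs

/-- Parallel surfaces of a Legendrian immersion. -/
theorem rotate (h : IsLegendrianOn U f e) {c s : ℝ} (hcs : c ^ 2 + s ^ 2 = 1) :
    IsLegendrianOn U (fun x => c • f x + s • e x) (fun x => (-s) • f x + c • e x) where
  isOpen := h.isOpen
  contDiffOn_fst := (h.contDiffOn_fst.const_smul c).add (h.contDiffOn_snd.const_smul s)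
  contDiffOn_snd := (h.contDiffOn_fst.const_smul (-s)).add (h.contDiffOn_snd.const_smul c)
  inner_fst_fst x hx := by
    simp only [inner_add_left, inner_add_right, real_inner_smul_left, real_inner_smul_right,
      h.inner_fst_fst x hx, h.inner_snd_snd x hx, h.inner_snd_fst x hx,
      real_inner_comm (e x) (f x)]
    linear_combination hcs
  inner_snd_snd x hx := by
    simp only [inner_add_left, inner_add_right, real_inner_smul_left, real_inner_smul_right,
      h.inner_fst_fst x hx, h.inner_snd_snd x hx, h.inner_snd_fst x hx,
      real_inner_comm (e x) (f x)]
    linear_combination hcs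
  inner_snd_fst x hx := by
    simp only [inner_add_left, inner_add_right, real_inner_smul_left, real_inner_smul_right,
      h.inner_fst_fst x hx, h.inner_snd_snd x hx, h.inner_snd_fst x hx,
      real_inner_comm (e x) (f x)]
    ring
  inner_snd_fderiv_fst x hx u := by
    obtain ⟨df, de⟩ := h.differentiableAt hx
    rw [fderiv_linearComb df de]
    simp only [inner_add_left, inner_add_right, real_inner_smul_left, real_inner_smul_right,
      h.inner_snd_fderiv_fst x hx, h.inner_fst_fderiv_fst hx, h.inner_fst_fderiv_snd hx,
      h.inner_snd_fderiv_snd hx]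
    ring
  eq_zero x hx u hu1 hu2 := by
    obtain ⟨df, de⟩ := h.differentiableAt hx
    rw [fderiv_linearComb df de] at hu1 hu2
    refine h.eq_zero x hx u ?_ ?_
    · rw [← one_smul ℝ (fderiv ℝ f x u), ← hcs]
      linear_combination (norm := module) c • hu1 - s • hu2
    · rw [← one_smul ℝ (fderiv ℝ e x u), ← hcs]
      linear_combination (norm := module) s • hu1 + c • hu2

end IsLegendrianOn

end Legendre

/-! ### Hypersurfaces in charts, and α as a cubic form -/

section Manifold

variable {n : ℕ} {M : Type*} [TopologicalSpace M] [ChartedSpace (E n) M] {F ν : M → E (n + 2)}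

instance (p : M) : FiniteDimensional ℝ (TangentSpace (𝓡 n) p) :=
  inferInstanceAs (FiniteDimensional ℝ (E n))

theorem finrank_tangentSpace (p : M) : finrank ℝ (TangentSpace (𝓡 n) p) = n :=
  (finrank_euclideanSpace_fin : finrank ℝ (E n) = n)

variable [IsManifold (𝓡 n) ∞ M]

theorem dChartSymm_injective {p : M} {x : E n} (hx : x ∈ (extChartAt (𝓡 n) p).target) :
    Function.Injective (dChartSymm p x) :=
  Function.LeftInverse.injective (g := dChart p _) fun v => dChart_dChartSymm hx v

namespace IsOrientedHypersurface

theorem injective_fderiv_inChart (h : IsOrientedHypersurface F ν) {p : M} {x : E n}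
    (hx : x ∈ (extChartAt (𝓡 n) p).target) : Function.Injective (fderiv ℝ (inChart F p) x) := by
  rw [fderiv_inChart h.contMDiff_F hx]
  exact (h.injective_deriv_F _).comp (dChartSymm_injective hx)

theorem isLegendrianOn (h : IsOrientedHypersurface F ν) (p : M) :
    IsLegendrianOn (extChartAt (𝓡 n) p).target (inChart F p) (inChart ν p) where
  isOpen := isOpen_extChartAt_target p
  contDiffOn_fst := contDiffOn_inChart h.contMDiff_F p
  contDiffOn_snd := contDiffOn_inChart h.contMDiff_ν p
  inner_fst_fst x _ := by
    rw [real_inner_self_eq_norm_sq, inChart, h.norm_F, one_pow]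
  inner_snd_snd x _ := by
    rw [real_inner_self_eq_norm_sq, inChart, h.norm_ν, one_pow]
  inner_snd_fst x _ := h.inner_ν_F _
  inner_snd_fderiv_fst x hx u := by
    rw [fderiv_inChart h.contMDiff_F hx]
    exact h.inner_ν_deriv_F _ _
  eq_zero x hx u hu _ := h.injective_fderiv_inChart hx (hu.trans (map_zero _).symm)

/-- The normal field of the hypersurface at a point of a chart: the tangent space is the orthogonal
complement of the position vector and the normal vector. -/
theorem mem_range_mvfderiv (h : IsOrientedHypersurface F ν) (p : M) {y : E (n + 2)}
    (h1 : ⟪F p, y⟫ = 0) (h2 : ⟪ν p, y⟫ = 0) : y ∈ (mvfderiv (𝓡 n) F p).range := by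
  set S : Submodule ℝ (E (n + 2)) := Submodule.span ℝ {F p, ν p}
  have hFν : ⟪F p, ν p⟫ = 0 := by rw [real_inner_comm]; exact h.inner_ν_F p
  have hmem : ∀ z, z ∈ Sᗮ ↔ ⟪F p, z⟫ = 0 ∧ ⟪ν p, z⟫ = 0 := by
    intro z
    rw [Submodule.mem_orthogonal]
    constructor
    · intro hz
      exact ⟨hz _ (Submodule.subset_span (by simp)), hz _ (Submodule.subset_span (by simp))⟩
    · rintro ⟨h1, h2⟩ u hu
      obtain ⟨a, b, rfl⟩ := Submodule.mem_span_pair.1 hu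
      simp [inner_add_left, inner_smul_left, h1, h2]
  have hx := mem_extChartAt_target (I := 𝓡 n) p
  have hle : (mvfderiv (𝓡 n) F p).range ≤ Sᗮ := by
    rintro _ ⟨X, rfl⟩
    rw [hmem]
    refine ⟨?_, h.inner_ν_deriv_F p X⟩
    have := (h.isLegendrianOn p).inner_fst_fderiv_fst hx (dChart p p X)
    rwa [inChart_extChartAt, fderiv_inChart_dChart h.contMDiff_F] at this
  have hS : finrank ℝ S = 2 := by
    have hli : LinearIndependent ℝ ![F p, ν p] := by
      rw [LinearIndependent.pair_iff]
      intro a b hab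
      have e1 := congrArg (fun z => ⟪F p, z⟫) hab
      have e2 := congrArg (fun z => ⟪ν p, z⟫) hab
      simp only [inner_add_right, real_inner_smul_right, hFν, h.inner_ν_F,
        real_inner_self_eq_norm_sq, h.norm_F, h.norm_ν, inner_zero_right] at e1 e2
      constructor <;> linarith
    have := finrank_span_eq_card hli
    rwa [Matrix.range_cons_cons_empty, Fintype.card_fin] at this
  have hrk : finrank ℝ (mvfderiv (𝓡 n) F p).range = n := by
    exact (LinearMap.finrank_range_of_inj (f := (mvfderiv (𝓡 n) F p).toLinearMap)
      (h.injective_deriv_F p)).trans (finrank_tangentSpace p)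
  have hfr : finrank ℝ Sᗮ = n := by
    have := S.finrank_add_finrank_orthogonal
    rw [hS, finrank_euclideanSpace_fin] at this
    omega
  -- F and ν span a plane in ℝⁿ⁺², so the range of dF, of dimension n, fills its orthogonal
  -- complement.
  rw [Submodule.eq_of_le_of_finrank_eq hle (hrk.trans hfr.symm), hmem]
  exact ⟨h1, h2⟩

/-- `shapeOperator` is built from an algebraic left inverse of dF, which is meaningful only on the
range of dF. The differential of ν does take values there, being orthogonal to F and ν. -/
theorem mvfderiv_shapeOperator (h : IsOrientedHypersurface F ν) (p : M)
    (X : TangentSpace (𝓡 n) p) :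
    mvfderiv (𝓡 n) F p (shapeOperator F ν p X) = -mvfderiv (𝓡 n) ν p X := by
  have hx := mem_extChartAt_target (I := 𝓡 n) p
  have h1 := (h.isLegendrianOn p).inner_fst_fderiv_snd hx (dChart p p X)
  have h2 := (h.isLegendrianOn p).inner_snd_fderiv_snd hx (dChart p p X)
  rw [inChart_extChartAt, fderiv_inChart_dChart h.contMDiff_ν] at h1 h2
  obtain ⟨Y, hY⟩ := h.mem_range_mvfderiv p h1 h2
  have hker : (mvfderiv (𝓡 n) F p).toLinearMap.ker = ⊥ :=
    LinearMap.ker_eq_bot.2 (h.injective_deriv_F p)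
  have : shapeOperator F ν p X = -Y := by
    simp only [shapeOperator, LinearMap.neg_apply, LinearMap.comp_apply]
    congr 1
    refine (congrArg _ hY.symm).trans ?_
    exact LinearMap.leftInverse_apply_of_inj hker Y
  rw [this, map_neg, ← hY]
  rfl

theorem isPullbackMetric_inducedMetric (h : IsOrientedHypersurface F ν) (p : M) :
    IsPullbackMetric (innerSL ℝ) (inChart F p) (extChartAt (𝓡 n) p).target
      (metricInChart (inducedMetric F) p) where
  isOpen := isOpen_extChartAt_target p
  contDiffOn := contDiffOn_inChart h.contMDiff_F p
  symm a b := real_inner_comm b a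
  nondeg x hx u hu := h.injective_fderiv_inChart hx <| by
    rw [map_zero]
    exact inner_self_eq_zero.1 hu
  eq x hx u v := by
    rw [fderiv_inChart h.contMDiff_F hx]
    rfl

theorem fderiv_shapeInChart (h : IsOrientedHypersurface F ν) {p : M} {x : E n}
    (hx : x ∈ (extChartAt (𝓡 n) p).target) (v : E n) :
    fderiv ℝ (inChart F p) x (shapeInChart F ν p x v) = -fderiv ℝ (inChart ν p) x v := by
  rw [fderiv_inChart h.contMDiff_F hx, fderiv_inChart h.contMDiff_ν hx]
  simp only [ContinuousLinearMap.comp_apply, shapeInChart, dChartSymm_dChart hx]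
  exact h.mvfderiv_shapeOperator _ _

theorem contDiffOn_shapeInChart (h : IsOrientedHypersurface F ν) (p : M) (v : E n) :
    ContDiffOn ℝ ∞ (fun x => shapeInChart F ν p x v) (extChartAt (𝓡 n) p).target := by
  have hG := h.isPullbackMetric_inducedMetric p
  have hL := h.isLegendrianOn p
  have hf := contDiffOn_fderiv hL.isOpen hL.contDiffOn_fst
  have he := contDiffOn_fderiv hL.isOpen hL.contDiffOn_snd
  have := hG.contDiffOn_sharp
    (φ := fun x w => -⟪fderiv ℝ (inChart ν p) x v, fderiv ℝ (inChart F p) x w⟫)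
    fun w => ((he.clm_apply contDiffOn_const).inner ℝ (hf.clm_apply contDiffOn_const)).neg
  refine this.congr fun x hx => hG.eq_of_forall hx fun w => ?_
  let φ : E n →ₗ[ℝ] ℝ := -((innerSL ℝ (fderiv ℝ (inChart ν p) x v)).comp
    (fderiv ℝ (inChart F p) x)).toLinearMap
  rw [h.fderiv_shapeInChart hx, show (fun w => -⟪fderiv ℝ (inChart ν p) x v,
    fderiv ℝ (inChart F p) x w⟫) = φ from rfl, hG.sharp_spec hx]
  exact inner_neg_left (𝕜 := ℝ) (fderiv ℝ (inChart ν p) x v) _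

/-- Differentiating dF(A v) = -dν(v) expresses dF of the derivative of A v by second derivatives.
Christoffel symbols are tangential parts of D²F, so Γ(u, A v) cancels one term, and A Γ(u, v)
becomes ⟨D²F(u, v), dν(z)⟩ by symmetry of A. Both the metric g₀ and A disappear, and the result
treats F and ν alike up to sign. -/
theorem alphaInChart_eq (h : IsOrientedHypersurface F ν) {p : M} {x : E n}
    (hx : x ∈ (extChartAt (𝓡 n) p).target) (w : Fin 3 → E n) :
    alphaInChart F ν p x w = cubicForm (inChart F p) (inChart ν p) x w := by
  have hG := h.isPullbackMetric_inducedMetric p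
  have hL := h.isLegendrianOn p
  have hn := hL.isOpen.mem_nhds hx
  set f : E n → E (n + 2) := inChart F p
  set e : E n → E (n + 2) := inChart ν p
  set A := shapeInChart F ν p
  obtain ⟨u, v, z, rfl⟩ : ∃ u v z, w = ![u, v, z] := ⟨w 0, w 1, w 2, by ext i; fin_cases i <;> rfl⟩
  have hA : ∀ y ∈ (extChartAt (𝓡 n) p).target, ∀ v, fderiv ℝ f y (A y v) = -fderiv ℝ e y v :=
    fun y hy v => h.fderiv_shapeInChart hy v
  have hdA : DifferentiableAt ℝ (fun y => A y v) x :=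
    ((h.contDiffOn_shapeInChart p v).contDiffAt hn).differentiableAt (by simp)
  have df : DifferentiableAt ℝ (fderiv ℝ f) x :=
    ((contDiffOn_fderiv hL.isOpen hL.contDiffOn_fst).contDiffAt hn).differentiableAt (by simp)
  have key : fderiv ℝ f x (fderiv ℝ (fun y => A y v) x u) =
      -hess e x u v - hess f x u (A x v) := by
    have e1 : (fun y => fderiv ℝ f y (A y v)) =ᶠ[nhds x] fun y => -fderiv ℝ e y v := by
      filter_upwards [hn] with y hy using hA y hy v
    have e2 := (df.hasFDerivAt.clm_apply hdA.hasFDerivAt).fderiv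
    have e3 := congrArg (fun L => L u) (e2.symm.trans e1.fderiv_eq)
    rw [fderiv_fun_neg] at e3
    simp only [neg_apply, fderiv_fderiv_apply hL.isOpen hL.contDiffOn_snd hx] at e3
    rw [← e3]
    simp [hess]
  have hz : fderiv ℝ e x z = -fderiv ℝ f x (A x z) := by rw [hA x hx, neg_neg]
  have hsp : ∀ u v w, ⟪fderiv ℝ f x (christoffel (metricInChart (inducedMetric F) p) x u v),
      fderiv ℝ f x w⟫ = ⟪hess f x u v, fderiv ℝ f x w⟫ := fun u v w => hG.christoffel_spec hx u v w
  rw [alphaInChart, hG.eq x hx, covDerivEnd, innerSL_apply_apply]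
  simp only [cubicForm, Matrix.cons_val_zero, Matrix.cons_val_one, Matrix.cons_val, map_add, map_sub]
  change ⟪fderiv ℝ f x (fderiv ℝ (fun y => A y v) x u) + fderiv ℝ f x (christoffel _ x u (A x v))
    - fderiv ℝ f x (A x (christoffel _ x u v)), fderiv ℝ f x z⟫ = _
  rw [hA x hx, inner_sub_left, inner_add_left, hsp, key, inner_neg_left,
    hL.inner_fderiv_comm hx, hz, inner_neg_left, real_inner_comm (fderiv ℝ f x (christoffel _ x u v)), hsp, inner_sub_left,
    inner_neg_left, inner_neg_right]
  ring

end IsOrientedHypersurface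

end Manifold

/-! ### Invariance of ĝ and sign change of α and its derivatives -/

section SymmetryIdentities

variable {n : ℕ} {M : Type*} [TopologicalSpace M] [ChartedSpace (E n) M] {F ν : M → E (n + 2)}

/-- Half of the inner product of `K × K`. -/
def halfInner (k : ℕ) : (E k × E k) →L[ℝ] (E k × E k) →L[ℝ] ℝ :=
  (1 / 2 : ℝ) • ((innerSL ℝ).bilinearComp (.fst ℝ (E k) (E k)) (.fst ℝ (E k) (E k)) +
    (innerSL ℝ).bilinearComp (.snd ℝ (E k) (E k)) (.snd ℝ (E k) (E k)))

theorem halfInner_apply {k : ℕ} (a b : E k × E k) :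
    halfInner k a b = (1 / 2 : ℝ) * (⟪a.1, b.1⟫ + ⟪a.2, b.2⟫) := rfl

/-- The real linear map `(a, b) ↦ (a + i b) / √2`. -/
def complexLift (k : ℕ) : (E k × E k) →L[ℝ] EuclideanSpace ℂ (Fin k) :=
  LinearMap.toContinuousLinearMap
    { toFun := fun q => WithLp.toLp 2 fun j =>
        (1 / (Real.sqrt 2 : ℂ)) * ((q.1 j : ℂ) + Complex.I * (q.2 j : ℂ))
      map_add' := fun a b => by
        ext j
        simp
        ring
      map_smul' := fun c a => by
        ext j
        simp
        ring }

theorem re_inner_complexLift {k : ℕ} (a b : E k × E k) :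
    (inner ℂ (complexLift k a) (complexLift k b)).re = halfInner k a b := by
  have h2 : (Real.sqrt 2)⁻¹ * (Real.sqrt 2)⁻¹ = 1 / 2 := by
    rw [← mul_inv, Real.mul_self_sqrt (by norm_num)]
    norm_num
  rw [halfInner_apply, PiLp.inner_apply, PiLp.inner_apply, PiLp.inner_apply, Complex.re_sum,
    ← Finset.sum_add_distrib, Finset.mul_sum]
  refine Finset.sum_congr rfl fun j _ => ?_
  simp [complexLift, ← Complex.ofReal_inv]
  linear_combination (a.1 j * b.1 j + a.2 j * b.2 j) * h2

/-- The diffeomorphism `τ` changes the pair `(F, ν)` by the reflection of the plane with matrix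
`!![c, s; s, -c]`. -/
structure ReflectsFrame (F ν : M → E (n + 2)) (c s : ℝ) (τ : M → M) : Prop where
  sq_add_sq : c ^ 2 + s ^ 2 = 1
  map_fst : ∀ p, F (τ p) = c • F p + s • ν p
  map_snd : ∀ p, ν (τ p) = s • F p + (-c) • ν p

/-- The condition at t = 0 already carries all the information; the converse below recovers every t
from the addition formulas. -/
theorem IsFocalReflection.reflectsFrame {θ : ℝ} {τ : M ≃ₘ^∞⟮𝓡 n, 𝓡 n⟯ M}
    (h : IsFocalReflection F ν θ τ) :
    ReflectsFrame F ν (Real.cos (2 * θ)) (Real.sin (2 * θ)) τ where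
  sq_add_sq := by rw [add_comm]; exact Real.sin_sq_add_cos_sq _
  map_fst p := by simpa [parallel] using (h 0 p).1
  map_snd p := by
    have := (h 0 p).2
    simp only [parallelNormal, Real.sin_zero, Real.cos_zero, sub_zero, neg_zero, zero_smul,
      zero_add, one_smul] at this
    rw [this]
    module

theorem ReflectsFrame.isFocalReflection {θ : ℝ} {τ : M ≃ₘ^∞⟮𝓡 n, 𝓡 n⟯ M}
    (h : ReflectsFrame F ν (Real.cos (2 * θ)) (Real.sin (2 * θ)) τ) :
    IsFocalReflection F ν θ τ := by
  intro t p
  simp only [parallel, parallelNormal, h.map_fst, h.map_snd, Real.cos_sub, Real.sin_sub]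
  constructor <;> module

namespace ReflectsFrame

variable {c s : ℝ}

/-- The matrix of a reflection squares to the identity, and F is injective. -/
theorem involutive (h : IsOrientedHypersurface F ν) {τ : M → M} (hτ : ReflectsFrame F ν c s τ)
    (p : M) : τ (τ p) = p := by
  apply h.isEmbedding_F.injective
  rw [hτ.map_fst, hτ.map_fst, hτ.map_snd]
  have : c • (c • F p + s • ν p) + s • (s • F p + -c • ν p) = (c ^ 2 + s ^ 2) • F p := by module
  rw [this, hτ.sq_add_sq, one_smul]

theorem unique (h : IsOrientedHypersurface F ν) {τ τ' : M → M} (hτ : ReflectsFrame F ν c s τ)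
    (hτ' : ReflectsFrame F ν c s τ') : τ = τ' := by
  funext p
  apply h.isEmbedding_F.injective
  rw [hτ.map_fst, hτ'.map_fst]

end ReflectsFrame

/-- Without complex numbers, the lift is the pair (F, ν) in a real product carrying half of its
inner product. -/
theorem IsOrientedHypersurface.gHat_eq (h : IsOrientedHypersurface F ν) (p : M)
    (X Y : TangentSpace (𝓡 n) p) :
    gHat F ν p X Y = halfInner (n + 2) (mvfderiv (𝓡 n) F p X, mvfderiv (𝓡 n) ν p X)
      (mvfderiv (𝓡 n) F p Y, mvfderiv (𝓡 n) ν p Y) := by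
  have h1 := (h.contMDiff_F.mdifferentiable (by simp) p).hasMFDerivAt
  have h2 := (h.contMDiff_ν.mdifferentiable (by simp) p).hasMFDerivAt
  have h3 := HasMFDerivAt.comp (f := fun p => (F p, ν p)) p (complexLift (n + 2)).hasMFDerivAt
    (show HasMFDerivAt (𝓡 n) 𝓘(ℝ, E (n + 2) × E (n + 2)) _ p _ from
      ⟨h1.1.prodMk h2.1, h1.2.prodMk h2.2⟩)
  have h4 : ∀ X, mvfderiv (𝓡 n) (lift F ν) p X =
      complexLift (n + 2) (mvfderiv (𝓡 n) F p X, mvfderiv (𝓡 n) ν p X) := fun X =>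
    congrArg (fun L => L X) h3.mfderiv
  rw [gHat, h4, h4, re_inner_complexLift]

variable [IsManifold (𝓡 n) ∞ M]

/-- The pair (F, ν) maps into a fixed flat space on which the frame reflection acts by a constant
linear isometry; this is the form `fderiv_christoffel` requires. -/
theorem IsOrientedHypersurface.isPullbackMetric_gHat (h : IsOrientedHypersurface F ν) (p : M) :
    IsPullbackMetric (halfInner (n + 2)) (fun x => (inChart F p x, inChart ν p x))
      (extChartAt (𝓡 n) p).target (metricInChart (gHat F ν) p) := by
  have hL := h.isLegendrianOn p
  have hd : ∀ x ∈ (extChartAt (𝓡 n) p).target, ∀ u,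
      fderiv ℝ (fun x => (inChart F p x, inChart ν p x)) x u =
        (fderiv ℝ (inChart F p) x u, fderiv ℝ (inChart ν p) x u) := by
    intro x hx u
    rw [((hL.differentiableAt hx).1.hasFDerivAt.prodMk
      (hL.differentiableAt hx).2.hasFDerivAt).fderiv]
    rfl
  constructor
  · exact hL.isOpen
  · exact hL.contDiffOn_fst.prodMk hL.contDiffOn_snd
  · intro a b
    rw [halfInner_apply, halfInner_apply, real_inner_comm, real_inner_comm a.2]
  · intro x hx u hu
    rw [hd x hx, halfInner_apply] at hu
    simp only at hu
    have h1 := real_inner_self_nonneg (x := fderiv ℝ (inChart F p) x u)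
    have h2 := real_inner_self_nonneg (x := fderiv ℝ (inChart ν p) x u)
    exact hL.eq_zero x hx u (inner_self_eq_zero (𝕜 := ℝ).1 (by linarith))
      (inner_self_eq_zero (𝕜 := ℝ).1 (by linarith))
  · intro x hx u v
    rw [hd x hx, hd x hx, fderiv_inChart h.contMDiff_F hx, fderiv_inChart h.contMDiff_ν hx]
    exact h.gHat_eq _ _ _

theorem IsSmoothTensorOn.congr {r : ℕ} {U : Set (E n)} {T S : E n → (Fin r → E n) → ℝ}
    (hT : IsSmoothTensorOn U T) (h : ∀ x ∈ U, ∀ w, S x w = T x w) : IsSmoothTensorOn U S where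
  contDiffOn w := (hT.contDiffOn w).congr fun x hx => h x hx w
  multilinear x hx := by
    obtain ⟨m, hm⟩ := hT.multilinear x hx
    exact ⟨m, fun w => (h x hx w).trans (hm w)⟩

theorem IsOrientedHypersurface.isSmoothTensorOn_nablaAlphaInChart
    (h : IsOrientedHypersurface F ν) (p : M) (i : ℕ) :
    IsSmoothTensorOn (extChartAt (𝓡 n) p).target (nablaAlphaInChart F ν p i) := by
  induction i with
  | zero =>
    have : IsSmoothTensorOn (extChartAt (𝓡 n) p).target (alphaInChart F ν p) :=
      (h.isLegendrianOn p).isSmoothTensorOn_cubicForm.congr fun x hx w => h.alphaInChart_eq hx w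
    exact this
  | succ i ih => exact (h.isPullbackMetric_gHat p).isSmoothTensorOn_covDeriv ih

namespace ReflectsFrame

variable {c s : ℝ}

omit [IsManifold (𝓡 n) ∞ M] in
theorem mvfderiv_comp (h : IsOrientedHypersurface F ν) {τ : M ≃ₘ^∞⟮𝓡 n, 𝓡 n⟯ M}
    (hτ : ReflectsFrame F ν c s τ) (p : M) (X : TangentSpace (𝓡 n) p) :
    mvfderiv (𝓡 n) F (τ p) (mfderiv (𝓡 n) (𝓡 n) τ p X) =
        c • mvfderiv (𝓡 n) F p X + s • mvfderiv (𝓡 n) ν p X ∧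
      mvfderiv (𝓡 n) ν (τ p) (mfderiv (𝓡 n) (𝓡 n) τ p X) =
        s • mvfderiv (𝓡 n) F p X + (-c) • mvfderiv (𝓡 n) ν p X := by
  have dF := h.contMDiff_F.mdifferentiable (by simp)
  have dν := h.contMDiff_ν.mdifferentiable (by simp)
  have dτ : MDifferentiableAt (𝓡 n) (𝓡 n) τ p := τ.contMDiff.mdifferentiable (by simp) p
  have key : ∀ (f : M → E (n + 2)) (a b : ℝ), MDifferentiable (𝓡 n) 𝓘(ℝ, E (n + 2)) f →
      (∀ p, f (τ p) = a • F p + b • ν p) →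
      mvfderiv (𝓡 n) f (τ p) (mfderiv (𝓡 n) (𝓡 n) τ p X) =
        a • mvfderiv (𝓡 n) F p X + b • mvfderiv (𝓡 n) ν p X := by
    intro f a b hf hfe
    have e1 := ((hf (τ p)).hasMFDerivAt.comp p dτ.hasMFDerivAt).mfderiv
    have e2 : f ∘ τ = a • F + b • ν := funext hfe
    have e3 := (((dF p).hasMFDerivAt.const_smul a).add ((dν p).hasMFDerivAt.const_smul b)).mfderiv
    rw [e2, e3] at e1
    exact (congrArg (fun L => L X) e1).symm
  exact ⟨key F c s dF hτ.map_fst, key ν s (-c) dν hτ.map_snd⟩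

omit [IsManifold (𝓡 n) ∞ M] in
theorem gHat_eq (h : IsOrientedHypersurface F ν) {τ : M ≃ₘ^∞⟮𝓡 n, 𝓡 n⟯ M}
    (hτ : ReflectsFrame F ν c s τ) (p : M) (X Y : TangentSpace (𝓡 n) p) :
    gHat F ν p X Y = gHat F ν (τ p) (mfderiv (𝓡 n) (𝓡 n) τ p X) (mfderiv (𝓡 n) (𝓡 n) τ p Y) := by
  simp only [h.gHat_eq, halfInner_apply, hτ.mvfderiv_comp h, inner_add_left, inner_add_right,
    real_inner_smul_left, real_inner_smul_right]
  linear_combination (-(1 / 2 : ℝ)) * (⟪mvfderiv (𝓡 n) F p X, mvfderiv (𝓡 n) F p Y⟫ +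
    ⟪mvfderiv (𝓡 n) ν p X, mvfderiv (𝓡 n) ν p Y⟫) * hτ.sq_add_sq

/-- The expression of `τ` in the preferred charts at `p` and `τ p`. -/
def _root_.Isoparametric.inCharts (τ : M → M) (p : M) : E n → E n :=
  inChart (fun q => extChartAt (𝓡 n) (τ p) (τ q)) p

/-- A domain of `inCharts τ p`. -/
def _root_.Isoparametric.inChartsDomain (τ : M → M) (p : M) : Set (E n) :=
  (extChartAt (𝓡 n) p).target ∩
    (extChartAt (𝓡 n) p).symm ⁻¹' (τ ⁻¹' (extChartAt (𝓡 n) (τ p)).source)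

omit [IsManifold (𝓡 n) ∞ M] in
theorem _root_.Isoparametric.isOpen_inChartsDomain {τ : M → M} (hτ : Continuous τ) (p : M) :
    IsOpen (inChartsDomain τ p : Set (E n)) :=
  (continuousOn_extChartAt_symm p).isOpen_inter_preimage (isOpen_extChartAt_target p)
    ((isOpen_extChartAt_source (τ p)).preimage hτ)

theorem _root_.Isoparametric.contDiffOn_inCharts {τ : M → M} (hτ : ContMDiff (𝓡 n) (𝓡 n) ∞ τ)
    (p : M) :
    ContDiffOn ℝ ∞ (inCharts τ p : E n → E n) (inChartsDomain τ p) := by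
  have h1 := contMDiffOn_extChartAt (I := 𝓡 n) (M := M) (n := ∞) (x := τ p)
  have h2 := hτ.comp_contMDiffOn (contMDiffOn_extChartAt_symm' p)
  have h3 : ContMDiffOn 𝓘(ℝ, E n) (𝓡 n) ∞ (τ ∘ (extChartAt (𝓡 n) p).symm)
    (inChartsDomain τ p) := h2.mono inter_subset_left
  refine (h1.comp h3 fun x hx => ?_).contDiffOn
  rw [mem_preimage, ← extChartAt_source (𝓡 n)]
  exact hx.2

omit [IsManifold (𝓡 n) ∞ M] in
theorem _root_.Isoparametric.inChart_inCharts {K : Type*} (f : M → K) {τ : M → M} {p : M} {x : E n}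
    (hx : x ∈ inChartsDomain τ p) : inChart f (τ p) (inCharts τ p x) =
      f (τ ((extChartAt (𝓡 n) p).symm x)) :=
  congrArg f ((extChartAt (𝓡 n) (τ p)).left_inv hx.2)

/-- The identity is proved on an open set of coordinates, not just at one point, since the induction
differentiates it. The start is the sign of the cubic form; each step is naturality of ∇ with factor
-1. -/
theorem nablaAlphaInChart_eq (h : IsOrientedHypersurface F ν) {τ : M → M}
    (hτs : ContMDiff (𝓡 n) (𝓡 n) ∞ τ) (hτ : ReflectsFrame F ν c s τ) (p : M) (i : ℕ) :
    ∀ x ∈ inChartsDomain τ p, ∀ w, nablaAlphaInChart F ν p i x w =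
      (-1) * nablaAlphaInChart F ν (τ p) i (inCharts τ p x)
        fun k => fderiv ℝ (inCharts τ p) x (w k) := by
  set W : Set (E n) := inChartsDomain τ p
  set ψ : E n → E n := inCharts τ p
  have hW : IsOpen W := isOpen_inChartsDomain hτs.continuous p
  have hψ : ContDiffOn ℝ ∞ ψ W := contDiffOn_inCharts hτs p
  have hWU : W ⊆ (extChartAt (𝓡 n) p).target := inter_subset_left
  have hψV : MapsTo ψ W (extChartAt (𝓡 n) (τ p)).target := fun x hx =>
    (extChartAt (𝓡 n) (τ p)).map_source hx.2
  have hL := h.isLegendrianOn p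
  have hL' := h.isLegendrianOn (τ p)
  have hF : ∀ x ∈ W, inChart F (τ p) (ψ x) = c • inChart F p x + s • inChart ν p x :=
    fun x hx => (inChart_inCharts F hx).trans (hτ.map_fst _)
  have hν : ∀ x ∈ W, inChart ν (τ p) (ψ x) = s • inChart F p x + (-c) • inChart ν p x :=
    fun x hx => (inChart_inCharts ν hx).trans (hτ.map_snd _)
  -- If dψ(u) = 0, then both rows of the invertible reflection matrix annihilate (dF(u), dν(u)), so
  -- dF(u) = dν(u) = 0 and u = 0.
  have hsurj : ∀ x ∈ W, Function.Surjective (fderiv ℝ ψ x) := by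
    intro x hx
    refine LinearMap.surjective_of_injective (f := (fderiv ℝ ψ x).toLinearMap)
      ((injective_iff_map_eq_zero _).2 fun u hu => ?_)
    change fderiv ℝ ψ x u = 0 at hu
    have hψd : DifferentiableAt ℝ ψ x :=
      (hψ.contDiffAt (hW.mem_nhds hx)).differentiableAt (by simp)
    obtain ⟨df, de⟩ := hL.differentiableAt (hWU hx)
    obtain ⟨df', de'⟩ := hL'.differentiableAt (hψV hx)
    have key : ∀ (f : M → E (n + 2)) (a b : ℝ), DifferentiableAt ℝ (inChart f (τ p)) (ψ x) →
        (∀ x ∈ W, inChart f (τ p) (ψ x) = a • inChart F p x + b • inChart ν p x) →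
        a • fderiv ℝ (inChart F p) x u + b • fderiv ℝ (inChart ν p) x u = 0 := by
      intro f a b hfd hf
      rw [← IsLegendrianOn.fderiv_linearComb df de]
      have ev : (fun y => a • inChart F p y + b • inChart ν p y) =ᶠ[nhds x]
          (inChart f (τ p)) ∘ ψ := by
        filter_upwards [hW.mem_nhds hx] with y hy using (hf y hy).symm
      rw [ev.fderiv_eq, fderiv_comp x hfd hψd, ContinuousLinearMap.comp_apply, hu, map_zero]
    have k1 := key F c s df' hF
    have k2 := key ν s (-c) de' hν
    have hcs := hτ.sq_add_sq
    refine hL.eq_zero x (hWU hx) u ?_ ?_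
    · rw [← one_smul ℝ (fderiv ℝ (inChart F p) x u), ← hcs]
      linear_combination (norm := module) c • k1 + s • k2
    · rw [← one_smul ℝ (fderiv ℝ (inChart ν p) x u), ← hcs]
      linear_combination (norm := module) s • k1 - c • k2
  let R : (E (n + 2) × E (n + 2)) →L[ℝ] (E (n + 2) × E (n + 2)) :=
    ContinuousLinearMap.prod (c • .fst ℝ _ _ + s • .snd ℝ _ _) (s • .fst ℝ _ _ + (-c) • .snd ℝ _ _)
  have hR : ∀ a b, halfInner (n + 2) (R a) (R b) = halfInner (n + 2) a b := by
    rintro ⟨a, a'⟩ ⟨b, b'⟩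
    change halfInner (n + 2) (c • a + s • a', s • a + (-c) • a')
      (c • b + s • b', s • b + (-c) • b') = _
    simp only [halfInner_apply, inner_add_left, inner_add_right, real_inner_smul_left,
      real_inner_smul_right]
    linear_combination (1 / 2 : ℝ) * (⟪a, b⟫ + ⟪a', b'⟫) * hτ.sq_add_sq
  have hΓ := fun x (hx : x ∈ W) => (h.isPullbackMetric_gHat p).fderiv_christoffel
    (h.isPullbackMetric_gHat (τ p)) hR hW hψ hWU hψV
    (fun x hx => Prod.ext (hF x hx) (hν x hx)) hx (hsurj x hx)
  induction i with
  | zero =>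
    intro x hx w
    rw [neg_one_mul]
    exact (h.alphaInChart_eq (hWU hx) w).trans
      ((hL.cubicForm_reflection hL' hW hψ hWU hψV hτ.sq_add_sq hF hν hx w).trans
        (congrArg _ (h.alphaInChart_eq (hψV hx) _).symm))
  | succ i ih =>
    intro x hx w
    exact (h.isPullbackMetric_gHat (τ p)).covDeriv_comp
      (h.isSmoothTensorOn_nablaAlphaInChart (τ p) i) hW hψ hψV ih hΓ hx w

theorem nablaAlpha_eq (h : IsOrientedHypersurface F ν) {τ : M ≃ₘ^∞⟮𝓡 n, 𝓡 n⟯ M}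
    (hτ : ReflectsFrame F ν c s τ) (i : ℕ) (p : M) (w : Fin (3 + i) → TangentSpace (𝓡 n) p) :
    nablaAlpha F ν i p w =
      -nablaAlpha F ν i (τ p) fun k => mfderiv (𝓡 n) (𝓡 n) τ p (w k) := by
  have hx : extChartAt (𝓡 n) p p ∈ inChartsDomain τ p :=
    ⟨mem_extChartAt_target p, by simp⟩
  have hψ : inCharts τ p (extChartAt (𝓡 n) p p) = extChartAt (𝓡 n) (τ p) (τ p) := by
    simp [inCharts, inChart]
  have dτ : MDifferentiableAt (𝓡 n) (𝓡 n) τ p := τ.contMDiff.mdifferentiable (by simp) p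
  have dφ : MDifferentiableAt (𝓡 n) 𝓘(ℝ, E n) (extChartAt (𝓡 n) (τ p)) (τ p) :=
    mdifferentiableAt_extChartAt (mem_chart_source _ _)
  have hd : ∀ X : TangentSpace (𝓡 n) p,
      fderiv ℝ (inCharts τ p) (extChartAt (𝓡 n) p p) (dChart p p X) =
        dChart (τ p) (τ p) (mfderiv (𝓡 n) (𝓡 n) τ p X) := by
    intro X
    exact (fderiv_inChart_dChart_of_mdifferentiableAt (dφ.comp p dτ) X).trans
      (congrArg (fun L => L X) (mfderiv_comp p dφ dτ))
  rw [nablaAlpha, hτ.nablaAlphaInChart_eq h τ.contMDiff p i _ hx, neg_one_mul, hψ]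
  simp only [hd]
  rfl

theorem alpha_eq (h : IsOrientedHypersurface F ν) {τ : M ≃ₘ^∞⟮𝓡 n, 𝓡 n⟯ M}
    (hτ : ReflectsFrame F ν c s τ) (p : M) (X Y Z : TangentSpace (𝓡 n) p) :
    alpha F ν p X Y Z = -alpha F ν (τ p) (mfderiv (𝓡 n) (𝓡 n) τ p X)
      (mfderiv (𝓡 n) (𝓡 n) τ p Y) (mfderiv (𝓡 n) (𝓡 n) τ p Z) := by
  have key : ∀ (q : M) (X Y Z : TangentSpace (𝓡 n) q),
      alpha F ν q X Y Z = nablaAlpha F ν 0 q ![X, Y, Z] := by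
    intro q X Y Z
    have hw : ![dChart q q X, dChart q q Y, dChart q q Z] =
        fun k : Fin 3 => dChart q q (![X, Y, Z] k) := by
      funext k
      fin_cases k <;> rfl
    rw [alpha, nablaAlpha, nablaAlphaInChart, hw]
  have hw : (fun k : Fin 3 => mfderiv (𝓡 n) (𝓡 n) τ p (![X, Y, Z] k)) =
      ![mfderiv (𝓡 n) (𝓡 n) τ p X, mfderiv (𝓡 n) (𝓡 n) τ p Y, mfderiv (𝓡 n) (𝓡 n) τ p Z] := by
    funext k
    fin_cases k <;> rfl
  rw [key, key, ← hw]
  exact hτ.nablaAlpha_eq h 0 p ![X, Y, Z]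

end ReflectsFrame

end SymmetryIdentities

/-! ### Circular arcs in the fibres of a map of constant rank -/

section Leaves

open Filter Topology

variable {n : ℕ} {K : Type*} [NormedAddCommGroup K] [InnerProductSpace ℝ K]

/-- The inverse function theorem, with the local inverse as a plain function. -/
theorem exists_local_inverse {V V' : Type*} [NormedAddCommGroup V] [NormedSpace ℝ V]
    [FiniteDimensional ℝ V] [NormedAddCommGroup V'] [NormedSpace ℝ V'] [FiniteDimensional ℝ V']
    (hV : finrank ℝ V = finrank ℝ V') {Φ : V → V'} {x₀ : V} (hΦ : ContDiffAt ℝ ∞ Φ x₀)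
    (hinj : Function.Injective (fderiv ℝ Φ x₀)) :
    ∃ g : V' → V, ContDiffAt ℝ ∞ g (Φ x₀) ∧ g (Φ x₀) = x₀ ∧ (∀ᶠ x in 𝓝 x₀, g (Φ x) = x) ∧
      ∀ᶠ y in 𝓝 (Φ x₀), Φ (g y) = y := by
  have : CompleteSpace V := FiniteDimensional.complete ℝ V
  let L : V ≃L[ℝ] V' :=
    (LinearMap.linearEquivOfInjective (fderiv ℝ Φ x₀).toLinearMap hinj hV).toContinuousLinearEquiv
  have hL : HasFDerivAt Φ (L : V →L[ℝ] V') x₀ := by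
    have : (L : V →L[ℝ] V') = fderiv ℝ Φ x₀ := by
      ext v
      rfl
    rw [this]
    exact (hΦ.differentiableAt (by simp)).hasFDerivAt
  let φ := hΦ.toOpenPartialHomeomorph Φ hL (by simp)
  have hx : x₀ ∈ φ.source := hΦ.mem_toOpenPartialHomeomorph_source hL (by simp)
  have hy : Φ x₀ ∈ φ.target := hΦ.image_mem_toOpenPartialHomeomorph_target hL (by simp)
  refine ⟨φ.symm, ?_, φ.left_inv hx, ?_, ?_⟩
  · exact hΦ.to_localInverse hL (by simp)
  · filter_upwards [φ.open_source.mem_nhds hx] with x hx using φ.left_inv hx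
  · filter_upwards [φ.open_target.mem_nhds hy] with y hy using φ.right_inv hy

theorem finrank_span_pair_orthonormal {a b : K} (ha : ⟪a, a⟫ = 1) (hb : ⟪b, b⟫ = 1)
    (hab : ⟪a, b⟫ = 0) : finrank ℝ (Submodule.span ℝ {a, b}) = 2 := by
  have hli : LinearIndependent ℝ ![a, b] := by
    rw [LinearIndependent.pair_iff]
    intro x y hxy
    have e1 := congrArg (fun z => ⟪a, z⟫) hxy
    have e2 := congrArg (fun z => ⟪b, z⟫) hxy
    simp only [inner_add_right, real_inner_smul_right, hab, real_inner_comm a b, ha, hb,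
      inner_zero_right] at e1 e2
    constructor <;> linarith
  have := finrank_span_eq_card hli
  rwa [Matrix.range_cons_cons_empty, Fintype.card_fin] at this

theorem mem_orthogonal_sup_span_pair {T : Submodule ℝ K} {a b z : K} :
    z ∈ (T ⊔ Submodule.span ℝ {a, b})ᗮ ↔ (∀ t ∈ T, ⟪t, z⟫ = 0) ∧ ⟪a, z⟫ = 0 ∧ ⟪b, z⟫ = 0 := by
  rw [← Submodule.inf_orthogonal, Submodule.mem_inf, Submodule.mem_orthogonal,
    Submodule.mem_orthogonal]
  refine and_congr_right fun _ => ⟨fun h => ⟨h _ (Submodule.subset_span (by simp)),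
    h _ (Submodule.subset_span (by simp))⟩, ?_⟩
  rintro ⟨h1, h2⟩ u hu
  obtain ⟨x, y, rfl⟩ := Submodule.mem_span_pair.1 hu
  simp [inner_add_left, inner_smul_left, h1, h2]

theorem finrank_orthogonal_sup_span_pair [FiniteDimensional ℝ K] {T : Submodule ℝ K} {a b : K}
    (ha : ⟪a, a⟫ = 1) (hb : ⟪b, b⟫ = 1) (hab : ⟪a, b⟫ = 0) (haT : ∀ t ∈ T, ⟪a, t⟫ = 0)
    (hbT : ∀ t ∈ T, ⟪b, t⟫ = 0) :
    finrank ℝ T + finrank ℝ (T ⊔ Submodule.span ℝ {a, b} : Submodule ℝ K)ᗮ + 2 = finrank ℝ K := by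
  have h1 := Submodule.finrank_sup_add_finrank_inf_eq T (Submodule.span ℝ {a, b})
  have h2 : T ⊓ Submodule.span ℝ {a, b} = ⊥ := by
    rw [Submodule.eq_bot_iff]
    rintro z ⟨hz1, hz2⟩
    obtain ⟨x, y, rfl⟩ := Submodule.mem_span_pair.1 hz2
    have e1 := haT _ hz1
    have e2 := hbT _ hz1
    simp only [inner_add_right, real_inner_smul_right, hab, real_inner_comm a b, ha, hb] at e1 e2
    have hx : x = 0 := by linarith
    have hy : y = 0 := by linarith
    simp [hx, hy]
  rw [h2, finrank_bot, finrank_span_pair_orthonormal ha hb hab] at h1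
  have h3 := (T ⊔ Submodule.span ℝ {a, b} : Submodule ℝ K).finrank_add_finrank_orthogonal
  omega

/-- The fibres of the first component of a Legendrian immersion contain short circular arcs, if it
has constant rank. -/
theorem IsLegendrianOn.eventually_exists_circle [FiniteDimensional ℝ K] {U : Set (E n)}
    {f e : E n → K} (h : IsLegendrianOn U f e) (hK : finrank ℝ K = n + 2) {x₀ : E n} (hx₀ : x₀ ∈ U)
    (hrank : ∀ x ∈ U, finrank ℝ (fderiv ℝ f x).range = finrank ℝ (fderiv ℝ f x₀).range)
    {v : K} (hv : ⟪v, v⟫ = 1) (hvf : ⟪f x₀, v⟫ = 0) (hve : ⟪e x₀, v⟫ = 0)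
    (hvT : ∀ t ∈ (fderiv ℝ f x₀).range, ⟪t, v⟫ = 0) :
    ∀ᶠ s in 𝓝 (0 : ℝ), ∃ x ∈ U, f x = f x₀ ∧ (fderiv ℝ f x).range ≤ (fderiv ℝ f x₀).range ∧
      e x = Real.cos s • e x₀ + Real.sin s • v := by
  set T : Submodule ℝ K := (fderiv ℝ f x₀).range with hT
  set N : Submodule ℝ K := (T ⊔ Submodule.span ℝ {f x₀, e x₀})ᗮ with hN
  have hfT : ∀ t ∈ T, ⟪f x₀, t⟫ = 0 := by
    rintro _ ⟨u, rfl⟩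
    exact h.inner_fst_fderiv_fst hx₀ u
  have heT : ∀ t ∈ T, ⟪e x₀, t⟫ = 0 := by
    rintro _ ⟨u, rfl⟩
    exact h.inner_snd_fderiv_fst x₀ hx₀ u
  have hdim : finrank ℝ (E n) = finrank ℝ (T × N) := by
    have : finrank ℝ T + finrank ℝ N + 2 = finrank ℝ K :=
      finrank_orthogonal_sup_span_pair (h.inner_fst_fst x₀ hx₀) (h.inner_snd_snd x₀ hx₀)
      (by rw [real_inner_comm]; exact h.inner_snd_fst x₀ hx₀) hfT heT
    rw [finrank_prod, finrank_euclideanSpace_fin]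
    omega
  set P : K →L[ℝ] T := T.orthogonalProjectionOnto with hP
  set Q : K →L[ℝ] N := N.orthogonalProjectionOnto with hQ
  have hPT : ∀ t (ht : t ∈ T), P t = ⟨t, ht⟩ := fun t ht =>
    T.orthogonalProjectionOnto_mem_subspace_eq_self ⟨t, ht⟩
  have hQN : ∀ t (ht : t ∈ N), Q t = ⟨t, ht⟩ := fun t ht =>
    N.orthogonalProjectionOnto_mem_subspace_eq_self ⟨t, ht⟩
  have hP0 : ∀ z, (∀ t ∈ T, ⟪t, z⟫ = 0) → P z = 0 := fun z hz =>
    Submodule.orthogonalProjectionOnto_eq_zero_iff.2 ((Submodule.mem_orthogonal _ _).2 hz)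
  have hQ0 : ∀ z ∈ T ⊔ Submodule.span ℝ {f x₀, e x₀}, Q z = 0 := fun z hz =>
    Submodule.orthogonalProjectionOnto_eq_zero_iff.2 (Submodule.le_orthogonal_orthogonal _ hz)
  -- Adapted coordinates: the tangential part of `f` and the part of `e` normal to T, f(x₀) and
  -- e(x₀). A vector in the kernel of dΦ has df(u) = 0, which puts de(u) in N by symmetry and hence
  -- makes it zero.
  set Φ : E n → T × N := fun x => (P (f x), Q (e x)) with hΦ
  have hΦs : ContDiffOn ℝ ∞ Φ U :=
    (P.contDiff.comp_contDiffOn h.contDiffOn_fst).prodMk (Q.contDiff.comp_contDiffOn h.contDiffOn_snd)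
  have hdΦ : ∀ x ∈ U, ∀ u, fderiv ℝ Φ x u = (P (fderiv ℝ f x u), Q (fderiv ℝ e x u)) := by
    intro x hx u
    obtain ⟨df, de⟩ := h.differentiableAt hx
    have := ((P.hasFDerivAt.comp x df.hasFDerivAt).prodMk
      (Q.hasFDerivAt.comp x de.hasFDerivAt)).fderiv
    exact congrArg (fun L => L u) this
  have hΦ0 : Φ x₀ = 0 := by
    refine Prod.ext (hP0 _ fun t ht => ?_) (hQ0 _ (Submodule.mem_sup_right
      (Submodule.subset_span (by simp))))
    rw [real_inner_comm]
    exact hfT t ht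
  have hinj : Function.Injective (fderiv ℝ Φ x₀) := by
    refine (injective_iff_map_eq_zero _).2 fun u hu => ?_
    rw [hdΦ x₀ hx₀, Prod.mk_eq_zero, hPT (fderiv ℝ f x₀ u) ⟨u, rfl⟩] at hu
    have h1 : fderiv ℝ f x₀ u = 0 := congrArg Subtype.val hu.1
    have h2 : fderiv ℝ e x₀ u ∈ N := by
      refine mem_orthogonal_sup_span_pair.2 ⟨?_, h.inner_fst_fderiv_snd hx₀ u,
        h.inner_snd_fderiv_snd hx₀ u⟩
      rintro _ ⟨w, rfl⟩
      change ⟪fderiv ℝ f x₀ w, _⟫ = 0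
      rw [real_inner_comm, h.inner_fderiv_comm hx₀, h1, inner_zero_right]
    have h3 : fderiv ℝ e x₀ u = 0 := by
      have := hu.2
      rw [hQN _ h2] at this
      exact congrArg Subtype.val this
    exact h.eq_zero x₀ hx₀ u h1 h3
  obtain ⟨g, hg, hg0, -, hΦg⟩ := exists_local_inverse hdim
    (hΦs.contDiffAt (h.isOpen.mem_nhds hx₀)) hinj
  rw [hΦ0] at hg hg0 hΦg
  have hgU : ∀ᶠ y in 𝓝 0, g y ∈ U := hg.continuousAt.eventually_mem (by
    rw [hg0]; exact h.isOpen.mem_nhds hx₀)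
  -- Kept to choose the sign later: the unit length of `e` only determines the square of its
  -- e(x₀)-component.
  have hge : ∀ᶠ y in 𝓝 0, 0 < ⟪e x₀, e (g y)⟫ := by
    have c1 : ContinuousAt e (g 0) := by rw [hg0]; exact (h.differentiableAt hx₀).2.continuousAt
    have : ContinuousAt (fun y => ⟪e x₀, e (g y)⟫) 0 :=
      continuousAt_const.inner (ContinuousAt.comp (f := g) c1 hg.continuousAt)
    refine this.eventually (lt_mem_nhds ?_)
    change 0 < ⟪e x₀, e (g 0)⟫
    rw [hg0, h.inner_snd_snd x₀ hx₀]
    exact one_pos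
  have hgd := (hg.of_le (m := 1) (by simp)).eventually (by simp)
  obtain ⟨r, hr, hball⟩ := Metric.eventually_nhds_iff_ball.1
    (hΦg.and (hgU.and (hge.and hgd)))
  set k : T × N → K := fun y => f (g y) with hk
  have hgdiff : ∀ y ∈ Metric.ball 0 r, DifferentiableAt ℝ g y := fun y hy =>
    (hball y hy).2.2.2.differentiableAt (by simp)
  have hkd : ∀ y ∈ Metric.ball 0 r, HasFDerivAt k ((fderiv ℝ f (g y)).comp (fderiv ℝ g y)) y :=
    fun y hy => (h.differentiableAt (hball y hy).2.1).1.hasFDerivAt.comp y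
      (hgdiff y hy).hasFDerivAt
  have hΦgd : ∀ y ∈ Metric.ball 0 r, ∀ w, fderiv ℝ Φ (g y) (fderiv ℝ g y w) = w := by
    intro y hy w
    have e1 : Φ ∘ g =ᶠ[𝓝 y] id := by
      filter_upwards [Metric.isOpen_ball.mem_nhds hy] with z hz using (hball z hz).1
    have e2 := e1.fderiv_eq (𝕜 := ℝ)
    rw [fderiv_comp y ((hΦs.contDiffAt (h.isOpen.mem_nhds
      (hball y hy).2.1)).differentiableAt (by simp)) (hgdiff y hy), fderiv_id] at e2
    exact congrArg (fun L => L w) e2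
  have hgsurj : ∀ y ∈ Metric.ball 0 r, Function.Surjective (fderiv ℝ g y) := fun y hy =>
    (LinearMap.injective_iff_surjective_of_finrank_eq_finrank (f := (fderiv ℝ g y).toLinearMap)
      hdim.symm).1 (Function.LeftInverse.injective (hΦgd y hy))
  -- Constant rank enters here. The projection P maps the range of df onto T, and equal dimensions
  -- make it injective there; moving in the N-direction does not change P f, so it does not change f
  -- to first order.
  have hk0 : ∀ y ∈ Metric.ball 0 r, ∀ b : N,
      fderiv ℝ f (g y) (fderiv ℝ g y (0, b)) = 0 := by
    intro y hy b
    have hgy := (hball y hy).2.1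
    let p : (fderiv ℝ f (g y)).range →ₗ[ℝ] T := P.toLinearMap.comp (Submodule.subtype _)
    have hp : Function.Surjective p := by
      intro t
      refine ⟨⟨fderiv ℝ f (g y) (fderiv ℝ g y (t, 0)), ⟨_, rfl⟩⟩, ?_⟩
      have := hΦgd y hy (t, 0)
      rw [hdΦ _ hgy] at this
      exact congrArg Prod.fst this
    have hpi := (LinearMap.injective_iff_surjective_of_finrank_eq_finrank (hrank _ hgy)).2 hp
    have hz : p ⟨fderiv ℝ f (g y) (fderiv ℝ g y (0, b)), ⟨_, rfl⟩⟩ = 0 := by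
      have := hΦgd y hy (0, b)
      rw [hdΦ _ hgy] at this
      exact congrArg Prod.fst this
    exact congrArg Subtype.val (hpi (hz.trans (map_zero p).symm))
  have hmem : ∀ (a : T) (b : N), (a, b) ∈ Metric.ball (0 : T × N) r ↔
      a ∈ Metric.ball 0 r ∧ b ∈ Metric.ball 0 r := by
    intro a b
    rw [show (0 : T × N) = (0, 0) from rfl, ← ball_prod_same, mem_prod]
  have hconst : ∀ a ∈ Metric.ball (0 : T) r, ∀ b ∈ Metric.ball (0 : N) r,
      k (a, b) = k (a, 0) := by
    intro a ha b hb
    have hd : ∀ b ∈ Metric.ball (0 : N) r, HasFDerivAt (fun b => k (a, b)) (0 : N →L[ℝ] K) b := by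
      intro b hb
      have h1 := (hkd (a, b) ((hmem a b).2 ⟨ha, hb⟩)).comp b
        ((hasFDerivAt_const a b).prodMk (hasFDerivAt_id b))
      refine h1.congr_fderiv ?_
      ext w
      exact (hk0 (a, b) ((hmem a b).2 ⟨ha, hb⟩) w)
    exact Metric.isOpen_ball.is_const_of_fderiv_eq_zero (𝕜 := ℝ)
      (convex_ball _ _).isPreconnected
      (fun b hb => (hd b hb).differentiableAt.differentiableWithinAt)
      (fun b hb => (hd b hb).fderiv) hb (Metric.mem_ball_self hr)
  have hvN : v ∈ N := mem_orthogonal_sup_span_pair.2 ⟨hvT, hvf, hve⟩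
  have hsin : ∀ᶠ s in 𝓝 (0 : ℝ), Real.sin s • (⟨v, hvN⟩ : N) ∈ Metric.ball 0 r := by
    have : ContinuousAt (fun s : ℝ => Real.sin s • (⟨v, hvN⟩ : N)) 0 := by fun_prop
    refine this.eventually_mem ?_
    simpa using Metric.ball_mem_nhds (0 : N) hr
  have hcos : ∀ᶠ s in 𝓝 (0 : ℝ), 0 < Real.cos s :=
    Real.continuous_cos.continuousAt.eventually (lt_mem_nhds (by simp))
  filter_upwards [hsin, hcos] with s hs hc
  set b : N := Real.sin s • (⟨v, hvN⟩ : N) with hb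
  have h0r : (0 : T) ∈ Metric.ball 0 r := Metric.mem_ball_self hr
  have hy : ((0 : T), b) ∈ Metric.ball (0 : T × N) r := (hmem 0 b).2 ⟨h0r, hs⟩
  have h00 : (0 : T × N) ∈ Metric.ball 0 r := Metric.mem_ball_self hr
  obtain ⟨hΦy, hgy, hpos, -⟩ := hball _ hy
  have hfx : f (g (0, b)) = f x₀ := by
    rw [← hg0]
    exact hconst 0 h0r b hs
  -- The function k depends only on the T-coordinate, so it is invariant under translation by (0, b)
  -- near 0, and its differentials at 0 and (0, b) agree.
  have hrange : (fderiv ℝ f (g (0, b))).range ≤ T := by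
    have e1 : (fun y => k (y + (0, b))) =ᶠ[𝓝 0] k := by
      have : ∀ᶠ y in 𝓝 (0 : T × N), y + (0, b) ∈ Metric.ball (0 : T × N) r := by
        have hc : ContinuousAt (fun y : T × N => y + (0, b)) 0 := by fun_prop
        refine hc.eventually_mem (Metric.isOpen_ball.mem_nhds ?_)
        rwa [zero_add]
      filter_upwards [this, Metric.ball_mem_nhds (0 : T × N) hr] with y hy hy'
      obtain ⟨a, c⟩ := y
      obtain ⟨ha, hc⟩ := (hmem a c).1 hy'
      have hab : (a, c) + (0, b) = (a, c + b) := by simp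
      rw [hab] at hy ⊢
      rw [hconst a ha _ ((hmem _ _).1 hy).2, hconst a ha c hc]
    have e2 := e1.fderiv_eq (𝕜 := ℝ)
    rw [fderiv_comp_add_right, zero_add, (hkd _ hy).fderiv, (hkd _ h00).fderiv, hg0] at e2
    rintro _ ⟨u, rfl⟩
    obtain ⟨w, rfl⟩ := hgsurj _ hy u
    exact ⟨fderiv ℝ g 0 w, (congrArg (fun L => L w) e2).symm⟩
  have hrange' : (fderiv ℝ f (g (0, b))).range = T :=
    Submodule.eq_of_le_of_finrank_eq hrange (hrank _ hgy)
  refine ⟨g (0, b), hgy, hfx, hrange, ?_⟩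
  set y := e (g (0, b)) with hyd
  set β := ⟪e x₀, y⟫ with hβ
  have hyT : ∀ t ∈ T, ⟪t, y⟫ = 0 := by
    intro t ht
    rw [← hrange'] at ht
    obtain ⟨u, rfl⟩ := ht
    rw [real_inner_comm]
    exact h.inner_snd_fderiv_fst _ hgy u
  have hTe : ∀ t ∈ T, ⟪t, e x₀⟫ = 0 := fun t ht => by rw [real_inner_comm]; exact heT t ht
  -- The difference lies in N while its projection to N is zero, so e(x) lies in the plane of e(x₀)
  -- and v. The N-coordinate was chosen as sin s times v.
  have hz : y - Real.sin s • v - β • e x₀ ∈ N := by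
    refine mem_orthogonal_sup_span_pair.2 ⟨fun t ht => ?_, ?_, ?_⟩
    · simp [inner_sub_right, real_inner_smul_right, hyT t ht, hvT t ht, hTe t ht]
    · have h1 : ⟪f x₀, y⟫ = 0 := by
        rw [← hfx, real_inner_comm]
        exact h.inner_snd_fst _ hgy
      have h2 : ⟪f x₀, e x₀⟫ = 0 := by
        rw [real_inner_comm]
        exact h.inner_snd_fst _ hx₀
      simp [inner_sub_right, real_inner_smul_right, h1, h2, hvf]
    · rw [inner_sub_right, inner_sub_right, real_inner_smul_right, real_inner_smul_right, hve,
        h.inner_snd_snd _ hx₀]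
      ring
  have hQz : Q (y - Real.sin s • v - β • e x₀) = 0 := by
    have h1 : Q y = b := congrArg Prod.snd hΦy
    have h2 : Q (e x₀) = 0 := hQ0 _ (Submodule.mem_sup_right (Submodule.subset_span (by simp)))
    rw [map_sub, map_sub, map_smul, map_smul, h1, h2, hQN v hvN, hb, smul_zero, sub_self, sub_self]
  have hy' : y = β • e x₀ + Real.sin s • v := by
    rw [hQN _ hz] at hQz
    have : y - Real.sin s • v - β • e x₀ = 0 := congrArg Subtype.val hQz
    linear_combination (norm := module) this
  have hβc : β = Real.cos s := by
    have h1 : ⟪y, y⟫ = 1 := h.inner_snd_snd _ hgy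
    rw [hy'] at h1
    simp only [inner_add_left, inner_add_right, real_inner_smul_left, real_inner_smul_right, hv,
      hve, real_inner_comm (e x₀) v, h.inner_snd_snd _ hx₀] at h1
    have h2 : β ^ 2 = Real.cos s ^ 2 := by
      rw [Real.cos_sq']
      linarith
    exact (sq_eq_sq₀ hpos.le hc.le).1 h2
  rw [hy', hβc]

end Leaves

/-! ### Existence of focal reflections on compact hypersurfaces -/

section Existence

open Filter Topology

variable {n : ℕ} {M : Type*} [TopologicalSpace M] [ChartedSpace (E n) M] {F ν : M → E (n + 2)}

theorem IsOrientedHypersurface.contMDiff_linearComb (h : IsOrientedHypersurface F ν) (a b : ℝ) :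
    ContMDiff (𝓡 n) 𝓘(ℝ, E (n + 2)) ∞ (fun p => a • F p + b • ν p) :=
  ContMDiff.comp (g := fun q : E (n + 2) × E (n + 2) => a • q.1 + b • q.2)
    ((contDiff_fst.const_smul a).add (contDiff_snd.const_smul b)).contMDiff
    (h.contMDiff_F.prodMk_space h.contMDiff_ν)

theorem IsOrientedHypersurface.mvfderiv_linearComb (h : IsOrientedHypersurface F ν) (a b : ℝ)
    (p : M) (X : TangentSpace (𝓡 n) p) :
    mvfderiv (𝓡 n) (fun p => a • F p + b • ν p) p X =
      a • mvfderiv (𝓡 n) F p X + b • mvfderiv (𝓡 n) ν p X := by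
  have dF := h.contMDiff_F.mdifferentiable (by simp)
  have dν := h.contMDiff_ν.mdifferentiable (by simp)
  have e3 := (((dF p).hasMFDerivAt.const_smul a).add ((dν p).hasMFDerivAt.const_smul b)).mfderiv
  exact congrArg (fun L => L X) e3

variable [IsManifold (𝓡 n) ∞ M]

/-- The kernel of the differential of a parallel surface consists of principal directions. -/
theorem IsOrientedHypersurface.mvfderiv_parallel_eq_zero_iff (h : IsOrientedHypersurface F ν)
    (θ : ℝ) (p : M) (X : TangentSpace (𝓡 n) p) :
    mvfderiv (𝓡 n) (parallel F ν θ) p X = 0 ↔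
      Real.sin θ • shapeOperator F ν p X = Real.cos θ • X := by
  have h1 : mvfderiv (𝓡 n) (parallel F ν θ) p X =
      mvfderiv (𝓡 n) F p (Real.cos θ • X - Real.sin θ • shapeOperator F ν p X) := by
    refine (h.mvfderiv_linearComb (Real.cos θ) (Real.sin θ) p X).trans ?_
    rw [map_sub, map_smul, map_smul, h.mvfderiv_shapeOperator]
    module
  rw [h1, ← map_zero (mvfderiv (𝓡 n) F p), (h.injective_deriv_F p).eq_iff, sub_eq_zero, eq_comm]

theorem sin_focalAngle_pos (c : ℝ) : 0 < Real.sin (focalAngle c) := by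
  rw [focalAngle, Real.sin_pi_div_two_sub]
  exact Real.cos_arctan_pos c

theorem cos_focalAngle (c : ℝ) :
    Real.cos (focalAngle c) = Real.sin (focalAngle c) * c := by
  rw [focalAngle, Real.sin_pi_div_two_sub, Real.cos_pi_div_two_sub, Real.sin_arctan,
    Real.cos_arctan]
  ring

theorem IsOrientedHypersurface.ker_mvfderiv_parallel (h : IsOrientedHypersurface F ν) (c : ℝ)
    (p : M) : (mvfderiv (𝓡 n) (parallel F ν (focalAngle c)) p).ker =
      (shapeOperator F ν p).eigenspace c := by
  ext X
  rw [Module.End.mem_eigenspace_iff]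
  refine (h.mvfderiv_parallel_eq_zero_iff _ p X).trans ?_
  rw [cos_focalAngle, mul_smul]
  exact (smul_right_injective _ (sin_focalAngle_pos c).ne').eq_iff

/-- Rank-nullity: the kernel is a principal space, whose dimension is the constant multiplicity. -/
theorem IsIsoparametric.finrank_range_mvfderiv_parallel (h : IsIsoparametric F ν) (c : ℝ)
    (p q : M) : finrank ℝ (mvfderiv (𝓡 n) (parallel F ν (focalAngle c)) p).range =
      finrank ℝ (mvfderiv (𝓡 n) (parallel F ν (focalAngle c)) q).range := by
  have key : ∀ p : M, finrank ℝ (mvfderiv (𝓡 n) (parallel F ν (focalAngle c)) p).range +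
      finrank ℝ ((shapeOperator F ν p).eigenspace c) = n := by
    intro p
    rw [← h.ker_mvfderiv_parallel]
    exact (LinearMap.finrank_range_add_finrank_ker
      (mvfderiv (𝓡 n) (parallel F ν (focalAngle c)) p).toLinearMap).trans (finrank_tangentSpace p)
  have h1 := key p
  have h2 := key q
  rw [h.finrank_eigenspace q p c] at h2
  omega

theorem range_fderiv_inChart_self {K : Type*} [NormedAddCommGroup K] [NormedSpace ℝ K] {f : M → K}
    (hf : ContMDiff (𝓡 n) 𝓘(ℝ, K) ∞ f) (p : M) :
    (fderiv ℝ (inChart f p) (extChartAt (𝓡 n) p p)).range = (mvfderiv (𝓡 n) f p).range := by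
  rw [range_fderiv_inChart hf (mem_extChartAt_target p)]
  exact congrArg (fun z => (mvfderiv (𝓡 n) f z).range) (extChartAt_to_inv p)

/-- If some coordinate vector is mapped outside T, it is still mapped outside T at nearby points.
Used to keep tangency to a fixed T under limits. -/
theorem isClosed_setOf_range_mvfderiv_le {K : Type*} [NormedAddCommGroup K] [NormedSpace ℝ K]
    [FiniteDimensional ℝ K] {f : M → K} (hf : ContMDiff (𝓡 n) 𝓘(ℝ, K) ∞ f) (T : Submodule ℝ K) :
    IsClosed {q : M | (mvfderiv (𝓡 n) f q).range ≤ T} := by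
  rw [← isOpen_compl_iff, isOpen_iff_mem_nhds]
  intro q hq
  obtain ⟨y, ⟨X, rfl⟩, hX⟩ := SetLike.not_le_iff_exists.1 (show ¬(mvfderiv (𝓡 n) f q).range ≤ T from hq)
  change mvfderiv (𝓡 n) f q X ∉ T at hX
  rw [← fderiv_inChart_dChart hf] at hX
  have hc : ContinuousAt (fun x => fderiv ℝ (inChart f q) x (dChart q q X))
      (extChartAt (𝓡 n) q q) :=
    (((contDiffOn_fderiv (isOpen_extChartAt_target q) (contDiffOn_inChart hf q)).continuousOn
      |>.continuousAt ((isOpen_extChartAt_target q).mem_nhds (mem_extChartAt_target q))).clm_apply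
        continuousAt_const)
  have hT : IsOpen (T : Set K)ᶜ := T.closed_of_finiteDimensional.isOpen_compl
  have h1 := hc.eventually_mem (hT.mem_nhds hX)
  have h2 := (continuousAt_extChartAt (I := 𝓡 n) q).eventually h1
  filter_upwards [h2, (isOpen_extChartAt_source (I := 𝓡 n) q).mem_nhds (mem_extChartAt_source q)]
    with z hz hzs hle
  refine hz (hle ?_)
  have h3 := range_fderiv_inChart hf ((extChartAt (𝓡 n) q).map_source hzs)
  have h4 := congrArg (fun z => (mvfderiv (𝓡 n) f z).range) ((extChartAt (𝓡 n) q).left_inv hzs)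
  rw [← h3.trans h4]
  exact ⟨_, rfl⟩

theorem IsOrientedHypersurface.isLegendrianOn_parallel (h : IsOrientedHypersurface F ν) (θ : ℝ)
    (p : M) : IsLegendrianOn (extChartAt (𝓡 n) p).target (inChart (parallel F ν θ) p)
      (inChart (parallelNormal F ν θ) p) :=
  (h.isLegendrianOn p).rotate (Real.cos_sq_add_sin_sq θ)

/-- On a compact hypersurface whose parallel surface at distance `θ` has constant rank less than
`n`, the leaves of the corresponding foliation are closed under the antipodal map. -/
theorem IsOrientedHypersurface.exists_antipode [CompactSpace M] (h : IsOrientedHypersurface F ν)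
    {θ : ℝ} (hrank : ∀ p q : M, finrank ℝ (mvfderiv (𝓡 n) (parallel F ν θ) p).range =
      finrank ℝ (mvfderiv (𝓡 n) (parallel F ν θ) q).range) {p : M} {X : TangentSpace (𝓡 n) p}
    (hX : X ≠ 0) (hX0 : mvfderiv (𝓡 n) (parallel F ν θ) p X = 0) :
    ∃ q, parallel F ν θ q = parallel F ν θ p ∧ parallelNormal F ν θ q = -parallelNormal F ν θ p := by
  set f := parallel F ν θ with hf
  set η := parallelNormal F ν θ with hη
  have hfs : ContMDiff (𝓡 n) 𝓘(ℝ, E (n + 2)) ∞ f := h.contMDiff_linearComb _ _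
  have hηs : ContMDiff (𝓡 n) 𝓘(ℝ, E (n + 2)) ∞ η := h.contMDiff_linearComb _ _
  set T := (mvfderiv (𝓡 n) f p).range with hT
  have hLp := h.isLegendrianOn_parallel θ p
  have hxp := mem_extChartAt_target (I := 𝓡 n) p
  have hdX : fderiv ℝ (inChart f p) (extChartAt (𝓡 n) p p) (dChart p p X) = 0 := by
    rw [fderiv_inChart_dChart hfs, hX0]
  set y := mvfderiv (𝓡 n) η p X with hy
  have hyd : fderiv ℝ (inChart η p) (extChartAt (𝓡 n) p p) (dChart p p X) = y :=
    fderiv_inChart_dChart hηs p X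
  have hy0 : y ≠ 0 := by
    intro hy0
    have h0 := hLp.eq_zero _ hxp _ hdX (hyd.trans hy0)
    have h1 : Function.Injective (dChart p p) :=
      (isInvertible_mfderiv_extChartAt (I := 𝓡 n) (mem_extChartAt_source p)).injective
    exact hX (h1 (h0.trans (map_zero _).symm))
  have hff : ∀ q, ⟪f q, f q⟫ = 1 := fun q => by
    simpa only [inChart_extChartAt] using (h.isLegendrianOn_parallel θ q).inner_fst_fst _
      (mem_extChartAt_target q)
  have hηη : ∀ q, ⟪η q, η q⟫ = 1 := fun q => by
    simpa only [inChart_extChartAt] using (h.isLegendrianOn_parallel θ q).inner_snd_snd _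
      (mem_extChartAt_target q)
  have hfη : ⟪f p, η p⟫ = 0 := by
    rw [real_inner_comm]
    simpa only [inChart_extChartAt] using hLp.inner_snd_fst _ hxp
  have hηT : ∀ t ∈ T, ⟪t, η p⟫ = 0 := by
    rintro _ ⟨Y, rfl⟩
    rw [real_inner_comm]
    have := hLp.inner_snd_fderiv_fst _ hxp (dChart p p Y)
    rwa [inChart_extChartAt, fderiv_inChart_dChart hfs] at this
  -- The initial direction of the circle: X is killed by dF_θ, so the immersed pair forces dν_θ(X) ≠
  -- 0, and symmetry makes it normal to the range of dF_θ.
  set v := ‖y‖⁻¹ • y with hv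
  have hvv : ⟪v, v⟫ = 1 := by
    rw [hv, real_inner_smul_left, real_inner_smul_right, real_inner_self_eq_norm_sq]
    field_simp [norm_ne_zero_iff.2 hy0]
  have hvf : ⟪f p, v⟫ = 0 := by
    have := hLp.inner_fst_fderiv_snd hxp (dChart p p X)
    rw [inChart_extChartAt, hyd] at this
    rw [hv, real_inner_smul_right, this, mul_zero]
  have hvη : ⟪η p, v⟫ = 0 := by
    have := hLp.inner_snd_fderiv_snd hxp (dChart p p X)
    rw [inChart_extChartAt, hyd] at this
    rw [hv, real_inner_smul_right, this, mul_zero]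
  have hvT : ∀ t ∈ T, ⟪t, v⟫ = 0 := by
    rintro _ ⟨Y, rfl⟩
    have := hLp.inner_fderiv_comm hxp (dChart p p X) (dChart p p Y)
    rw [hyd, hdX, inner_zero_right, fderiv_inChart_dChart hfs, real_inner_comm] at this
    rw [hv, real_inner_smul_right]
    change _ * ⟪mvfderiv (𝓡 n) f p Y, y⟫ = 0
    rw [this, mul_zero]
  -- The range condition travels with the fibre so that the fixed vectors of the circle remain
  -- normal to the range of the differential at every point reached.
  set C : Set M := {q | f q = f p ∧ (mvfderiv (𝓡 n) f q).range ≤ T} with hC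
  have hCc : IsClosed C := (isClosed_eq hfs.continuous continuous_const).inter
    (isClosed_setOf_range_mvfderiv_le hfs T)
  set S : Set ℝ := {s | ∃ q ∈ C, η q = Real.cos s • η p + Real.sin s • v} with hS
  -- Projection along the compact M is a closed map; this is where compactness is needed.
  have hSc : IsClosed S := by
    have h1 : IsClosed {z : ℝ × M | z.2 ∈ C ∧ η z.2 = Real.cos z.1 • η p + Real.sin z.1 • v} := by
      refine (hCc.preimage continuous_snd).inter (isClosed_eq (hηs.continuous.comp continuous_snd) ?_)
      have := Real.continuous_cos.comp (continuous_fst (X := ℝ) (Y := M))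
      have := Real.continuous_sin.comp (continuous_fst (X := ℝ) (Y := M))
      fun_prop
    convert! isClosedMap_fst_of_compactSpace _ h1
    ext s
    constructor
    · rintro ⟨q, hq⟩
      exact ⟨(s, q), hq, rfl⟩
    · rintro ⟨⟨s, q⟩, hq, rfl⟩
      exact ⟨q, hq⟩
  have hSo : ∀ s ∈ S, ∀ᶠ t in 𝓝 (0 : ℝ), s + t ∈ S := by
    rintro s ⟨q, ⟨hq1, hq2⟩, hq3⟩
    -- The unit tangent of the circle at angle s, from which the local arc is restarted at `q`; the
    -- addition formulas join the two arcs.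
    set v' := -Real.sin s • η p + Real.cos s • v with hv'
    have hLq := h.isLegendrianOn_parallel θ q
    have hTq := range_fderiv_inChart_self hfs q
    have hcs := Real.cos_sq_add_sin_sq s
    have := hLq.eventually_exists_circle finrank_euclideanSpace_fin (mem_extChartAt_target q)
      (v := v') (fun x hx => by rw [hTq, range_fderiv_inChart hfs hx]; exact hrank _ _)
      (by
        simp only [hv', inner_add_left, inner_add_right, real_inner_smul_left,
          real_inner_smul_right, hηη, hvv, hvη, real_inner_comm (η p) v]
        linarith)
      (by
        rw [inChart_extChartAt, ← hf, hq1, hv', inner_add_right, real_inner_smul_right,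
          real_inner_smul_right, hfη, hvf]
        ring)
      (by
        rw [inChart_extChartAt, ← hη, hq3]
        simp only [hv', inner_add_left, inner_add_right, real_inner_smul_left,
          real_inner_smul_right, hηη, hvv, hvη, real_inner_comm (η p) v]
        ring)
      (by
        intro t ht
        rw [hTq] at ht
        rw [hv', inner_add_right, real_inner_smul_right, real_inner_smul_right, hηT t (hq2 ht),
          hvT t (hq2 ht)]
        ring)
    filter_upwards [this] with t ht
    obtain ⟨x, hx, hx1, hx2, hx3⟩ := ht
    rw [inChart_extChartAt, ← hf, hq1] at hx1
    rw [inChart_extChartAt, ← hη, hq3] at hx3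
    rw [hTq, range_fderiv_inChart hfs hx] at hx2
    refine ⟨(extChartAt (𝓡 n) q).symm x, ⟨hx1, hx2.trans hq2⟩, ?_⟩
    refine hx3.trans ?_
    rw [hv', Real.cos_add, Real.sin_add]
    module
  have hIcc : Icc 0 Real.pi ⊆ S := by
    refine (hSc.inter isClosed_Icc).Icc_subset_of_forall_exists_gt
      ⟨p, ⟨rfl, le_rfl⟩, by simp⟩ ?_
    rintro s ⟨hs, -⟩ b (hb : s < b)
    obtain ⟨ε, hε, hball⟩ := Metric.eventually_nhds_iff_ball.1 (hSo s hs)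
    have hpos : 0 < min (ε / 2) (b - s) := lt_min (by linarith) (by linarith)
    refine ⟨s + min (ε / 2) (b - s), hball _ ?_, ?_, ?_⟩
    · rw [mem_ball_zero_iff, Real.norm_of_nonneg hpos.le]
      exact (min_le_left _ _).trans_lt (by linarith)
    · linarith
    · linarith [min_le_right (ε / 2) (b - s)]
  obtain ⟨q, hq, hq2⟩ := hIcc ⟨Real.pi_pos.le, le_rfl⟩
  exact ⟨q, hq.1, by simpa using hq2⟩

/-- A continuous map whose composition with an immersion is smooth is smooth. -/
theorem IsOrientedHypersurface.contMDiff_of_comp (h : IsOrientedHypersurface F ν) {τ : M → M}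
    (hτ : ContMDiff (𝓡 n) 𝓘(ℝ, E (n + 2)) ∞ (F ∘ τ)) : ContMDiff (𝓡 n) (𝓡 n) ∞ τ := by
  have hτc : Continuous τ := h.isEmbedding_F.continuous_iff.2 hτ.continuous
  intro p
  set q := τ p with hq
  set x₀ := extChartAt (𝓡 n) q q with hx₀
  have hx : x₀ ∈ (extChartAt (𝓡 n) q).target := mem_extChartAt_target q
  have hn := (isOpen_extChartAt_target (I := 𝓡 n) q).mem_nhds hx
  -- Projecting to the tangent space at τ(p) makes F a local diffeomorphism. Its local inverse
  -- writes τ near p as a smooth function of F ∘ τ; continuity of τ keeps the values in the chart.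
  set T : Submodule ℝ (E (n + 2)) := (fderiv ℝ (inChart F q) x₀).range
  set P : E (n + 2) →L[ℝ] T := T.orthogonalProjectionOnto
  have hinj := h.injective_fderiv_inChart hx
  have hFs : ContDiffAt ℝ ∞ (inChart F q) x₀ := (contDiffOn_inChart h.contMDiff_F q).contDiffAt hn
  have hdim : finrank ℝ (E n) = finrank ℝ T :=
    (LinearMap.finrank_range_of_inj (f := (fderiv ℝ (inChart F q) x₀).toLinearMap) hinj).symm
  have hdΦ : ∀ u, fderiv ℝ (fun x => P (inChart F q x)) x₀ u =
      ⟨fderiv ℝ (inChart F q) x₀ u, u, rfl⟩ := by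
    intro u
    have := (P.hasFDerivAt.comp x₀ (hFs.differentiableAt (by simp)).hasFDerivAt).fderiv
    refine (congrArg (fun L => L u) this).trans ?_
    exact T.orthogonalProjectionOnto_mem_subspace_eq_self ⟨fderiv ℝ (inChart F q) x₀ u, u, rfl⟩
  obtain ⟨g, hg, hg0, hgl, -⟩ := exists_local_inverse hdim
    (Φ := fun x => P (inChart F q x)) (P.contDiff.contDiffAt.comp x₀ hFs)
    (fun u u' huu => by
      rw [hdΦ, hdΦ] at huu
      exact hinj (congrArg Subtype.val huu))
  have hev : τ =ᶠ[𝓝 p] fun p' => (extChartAt (𝓡 n) q).symm (g (P (F (τ p')))) := by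
    have h1 : ∀ᶠ q' in 𝓝 q, g (P (inChart F q (extChartAt (𝓡 n) q q'))) = extChartAt (𝓡 n) q q' :=
      (continuousAt_extChartAt (I := 𝓡 n) q).eventually hgl
    have h2 : ∀ᶠ q' in 𝓝 q, q' ∈ (extChartAt (𝓡 n) q).source :=
      (isOpen_extChartAt_source q).mem_nhds (mem_extChartAt_source q)
    filter_upwards [hτc.continuousAt.eventually (h1.and h2)] with p' hp'
    have h3 := hp'.1
    rw [inChart, (extChartAt (𝓡 n) q).left_inv hp'.2] at h3
    rw [h3, (extChartAt (𝓡 n) q).left_inv hp'.2]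
  refine ContMDiffAt.congr_of_eventuallyEq ?_ hev
  have hFq : P (F (τ p)) = P (inChart F q x₀) := by rw [hx₀, inChart_extChartAt]
  have c1 : ContMDiffAt (𝓡 n) 𝓘(ℝ, T) ∞ (fun p' => P (F (τ p'))) p :=
    P.contMDiff.contMDiffAt.comp p (hτ p)
  have c2 : ContMDiffAt (𝓡 n) 𝓘(ℝ, E n) ∞ (fun p' => g (P (F (τ p')))) p :=
    ContMDiffAt.comp (g := g) p (by rw [hFq]; exact hg.contMDiffAt) c1
  refine ContMDiffAt.comp (g := (extChartAt (𝓡 n) q).symm) p ?_ c2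
  rw [hFq, hg0]
  exact (contMDiffOn_extChartAt_symm' q).contMDiffAt hn

/-- An involution of `M` that reflects the frame `(F, ν)` is a diffeomorphism. -/
theorem ReflectsFrame.exists_diffeomorph (h : IsOrientedHypersurface F ν) {c s : ℝ} {τ : M → M}
    (hτ : ReflectsFrame F ν c s τ) : ∃ τ' : M ≃ₘ^∞⟮𝓡 n, 𝓡 n⟯ M, ⇑τ' = τ := by
  have hs : ContMDiff (𝓡 n) (𝓡 n) ∞ τ := h.contMDiff_of_comp <| by
    rw [show F ∘ τ = fun p => c • F p + s • ν p from funext hτ.map_fst]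
    exact h.contMDiff_linearComb c s
  exact ⟨{ toEquiv := ⟨τ, τ, hτ.involutive h, hτ.involutive h⟩
           contMDiff_toFun := hs
           contMDiff_invFun := hs }, rfl⟩

/-- On a compact isoparametric hypersurface the reflections in the focal submanifolds exist. -/
theorem IsIsoparametric.exists_isFocalReflection [CompactSpace M] (h : IsIsoparametric F ν) {c : ℝ}
    (hc : ∀ p, (shapeOperator F ν p).HasEigenvalue c) :
    ∃ τ : M ≃ₘ^∞⟮𝓡 n, 𝓡 n⟯ M, IsFocalReflection F ν (focalAngle c) τ := by
  set θ := focalAngle c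
  have hex : ∀ p, ∃ q, parallel F ν θ q = parallel F ν θ p ∧
      parallelNormal F ν θ q = -parallelNormal F ν θ p := by
    intro p
    obtain ⟨X, hX, hX0⟩ := (hc p).exists_hasEigenvector
    have hX : X ∈ (mvfderiv (𝓡 n) (parallel F ν θ) p).ker := by
      rw [h.ker_mvfderiv_parallel]
      exact hX
    exact h.exists_antipode (h.finrank_range_mvfderiv_parallel c) hX0 hX
  choose τ hτ1 hτ2 using hex
  have hcs := Real.cos_sq_add_sin_sq θ
  have hF : ∀ p, F p = Real.cos θ • parallel F ν θ p - Real.sin θ • parallelNormal F ν θ p := by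
    intro p
    simp only [parallel, parallelNormal]
    conv_lhs => rw [← one_smul ℝ (F p), ← hcs]
    module
  have hν : ∀ p, ν p = Real.sin θ • parallel F ν θ p + Real.cos θ • parallelNormal F ν θ p := by
    intro p
    simp only [parallel, parallelNormal]
    conv_lhs => rw [← one_smul ℝ (ν p), ← hcs]
    module
  -- In the rotated frame (F_θ, ν_θ) the map is diag(1, -1); conjugating back by the rotation
  -- doubles the angle. Smoothness of the chosen τ is not needed yet, since it follows from these
  -- identities.
  have hτ : ReflectsFrame F ν (Real.cos (2 * θ)) (Real.sin (2 * θ)) τ := by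
    refine ⟨Real.cos_sq_add_sin_sq _, fun p => ?_, fun p => ?_⟩
    · rw [hF (τ p), hτ1, hτ2, Real.cos_two_mul', Real.sin_two_mul]
      simp only [parallel, parallelNormal]
      module
    · rw [hν (τ p), hτ1, hτ2, Real.cos_two_mul', Real.sin_two_mul]
      simp only [parallel, parallelNormal]
      module
  obtain ⟨τ', rfl⟩ := hτ.exists_diffeomorph h.toIsOrientedHypersurface
  exact ⟨τ', hτ.isFocalReflection⟩

end Existence

/-! ### Equal spacing of the focal distances -/

section Angles

/-- A finite subset of a half-open interval of length `π` whose translates by multiples of `π` are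
symmetric with respect to each of their points is equally spaced. -/
theorem eq_add_mul_pi_div {g : ℕ} (hg : 0 < g) {θ : Fin g → ℝ} (hθ : StrictMono θ)
    (hlt : ∀ j, θ j < θ ⟨0, hg⟩ + Real.pi)
    (hsymm : ∀ j k, ∃ l, ∃ m : ℤ, 2 * θ j - θ k = θ l + m * Real.pi) (j : Fin g) :
    θ j = θ ⟨0, hg⟩ + (j : ℕ) * (Real.pi / g) := by
  have hpi := Real.pi_pos
  -- The increasing enumeration of all θ l + mπ that are at least the first angle; it advances by π
  -- after g steps.
  let a : ℕ → ℝ := fun i => θ ⟨i % g, Nat.mod_lt i hg⟩ + (i / g : ℕ) * Real.pi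
  have ha : ∀ (q : ℕ) (r : Fin g), a (g * q + r) = θ r + q * Real.pi := by
    intro q r
    have h1 : (g * q + r) % g = r := by rw [Nat.mul_add_mod, Nat.mod_eq_of_lt r.2]
    have h2 : (g * q + r) / g = q := by
      rw [Nat.mul_add_div hg, Nat.div_eq_of_lt r.2, add_zero]
    simp only [a, h1, h2]
  have ha' : ∀ r : Fin g, a r = θ r := fun r => by simpa using ha 0 r
  have ha0 : a 0 = θ ⟨0, hg⟩ := ha' ⟨0, hg⟩
  have hag : a g = θ ⟨0, hg⟩ + Real.pi := by simpa using ha 1 ⟨0, hg⟩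
  have hmono : StrictMono a := by
    refine strictMono_nat_of_lt_succ fun i => ?_
    obtain ⟨q, r, rfl⟩ : ∃ (q : ℕ) (r : Fin g), i = g * q + r :=
      ⟨i / g, ⟨i % g, Nat.mod_lt i hg⟩, (Nat.div_add_mod i g).symm⟩
    rw [ha]
    by_cases hr : (r : ℕ) + 1 < g
    · have := ha q ⟨r + 1, hr⟩
      rw [← add_assoc] at this
      rw [this]
      exact add_lt_add_left (hθ (Fin.lt_def.2 (Nat.lt_succ_self r))) _
    · have hr' : g * q + r + 1 = g * (q + 1) + (⟨0, hg⟩ : Fin g) := by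
        have := r.2
        simp only [mul_add, mul_one]
        omega
      rw [hr', ha]
      push_cast
      linarith [hlt r]
  have hmem : ∀ i k : ℕ, ∃ l, ∃ m : ℤ, 2 * a i - a k = θ l + m * Real.pi := by
    intro i k
    obtain ⟨l, m, hlm⟩ := hsymm ⟨i % g, Nat.mod_lt i hg⟩ ⟨k % g, Nat.mod_lt k hg⟩
    refine ⟨l, m + 2 * ((i / g : ℕ) : ℤ) - ((k / g : ℕ) : ℤ), ?_⟩
    simp only [a, Int.cast_sub, Int.cast_add, Int.cast_mul, Int.cast_ofNat, Int.cast_natCast]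
    linear_combination hlm
  -- A negative m would put the value below the first angle, since all angles lie within π of it.
  have hnat : ∀ (l : Fin g) (m : ℤ), a 0 ≤ θ l + m * Real.pi → ∃ i, a i = θ l + m * Real.pi := by
    intro l m h
    have hm : 0 ≤ m := by
      by_contra hm
      have h1 : (m : ℝ) ≤ -1 := by exact_mod_cast (by omega : m ≤ -1)
      have h2 : (m : ℝ) * Real.pi ≤ -1 * Real.pi := mul_le_mul_of_nonneg_right h1 hpi.le
      linarith [hlt l]
    obtain ⟨q, rfl⟩ := Int.eq_ofNat_of_zero_le hm
    exact ⟨g * q + l, by rw [ha]; rfl⟩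
  -- Reflect a neighbour of a (i + 1) in it. The image of a (i + 2) lies in the set below a (i + 1),
  -- so it is at most a i; the image of a i lies above, so it is at least a (i + 2). The two
  -- inequalities make consecutive gaps equal.
  have hgap : ∀ i, a (i + 2) - a (i + 1) = a (i + 1) - a i := by
    intro i
    have h1 : 2 * a (i + 1) - a (i + 2) ≤ a i := by
      obtain ⟨l, m, hlm⟩ := hmem (i + 1) (i + 2)
      rw [hlm]
      by_contra! hc
      obtain ⟨k, hk⟩ := hnat l m ((hmono.monotone (Nat.zero_le i)).trans hc.le)
      rw [← hk] at hc hlm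
      have h2 := hmono.lt_iff_lt.1 hc
      have h3 : a (i + 1) ≤ a k := hmono.monotone h2
      linarith [hmono (Nat.lt_succ_self (i + 1))]
    have h2 : a (i + 2) ≤ 2 * a (i + 1) - a i := by
      obtain ⟨l, m, hlm⟩ := hmem (i + 1) i
      have h3 : a (i + 1) < 2 * a (i + 1) - a i := by linarith [hmono (Nat.lt_succ_self i)]
      rw [hlm] at h3 ⊢
      obtain ⟨k, hk⟩ := hnat l m ((hmono.monotone (Nat.zero_le (i + 1))).trans h3.le)
      rw [← hk] at h3 ⊢
      exact hmono.monotone (hmono.lt_iff_lt.1 h3)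
    linarith
  have hlin : ∀ i : ℕ, a i = a 0 + i * (a 1 - a 0) ∧ a (i + 1) = a 0 + (i + 1) * (a 1 - a 0) := by
    intro i
    induction i with
    | zero => simp
    | succ i ih =>
      refine ⟨by push_cast; exact ih.2, ?_⟩
      push_cast
      linarith [hgap i, ih.1, ih.2]
  have hd : a 1 - a 0 = Real.pi / g := by
    have h1 := (hlin g).1
    rw [hag, ← ha0] at h1
    have : (g : ℝ) ≠ 0 := by exact_mod_cast hg.ne'
    field_simp
    linarith
  rw [← ha', (hlin j).1, hd, ha0]

end Angles

/-! ### Focal distances under reflections, and the dihedral group -/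

section Dihedral

variable {n : ℕ} {M : Type*} [TopologicalSpace M] [ChartedSpace (E n) M] {F ν : M → E (n + 2)}

theorem focalAngle_strictAnti : StrictAnti focalAngle := fun a b hab => by
  have := Real.arctan_strictMono hab
  simp only [focalAngle]
  linarith

theorem focalAngle_mem_Ioo (c : ℝ) : focalAngle c ∈ Ioo 0 Real.pi := by
  have h1 := Real.arctan_lt_pi_div_two c
  have h2 := Real.neg_pi_div_two_lt_arctan c
  constructor <;> simp only [focalAngle] <;> linarith

/-- The cotangent determines an angle modulo π. -/
theorem exists_eq_focalAngle_add {θ c : ℝ} (h : Real.cos θ = Real.sin θ * c) :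
    ∃ m : ℤ, θ = focalAngle c + m * Real.pi := by
  have h1 : Real.sin (θ - focalAngle c) = 0 := by
    rw [Real.sin_sub, cos_focalAngle, h]
    ring
  obtain ⟨m, hm⟩ := Real.sin_eq_zero_iff.1 h1
  exact ⟨m, by linarith⟩

variable [IsManifold (𝓡 n) ∞ M]

/-- The focal distances of a hypersurface are symmetric with respect to a focal reflection. -/
theorem IsOrientedHypersurface.exists_two_mul_sub_focalAngle (h : IsOrientedHypersurface F ν)
    {c θ : ℝ} {τ : M ≃ₘ^∞⟮𝓡 n, 𝓡 n⟯ M} (hτ : IsFocalReflection F ν θ τ) {p : M}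
    (hc : (shapeOperator F ν p).HasEigenvalue c) : ∃ c', ∃ m : ℤ,
      (shapeOperator F ν (τ p)).HasEigenvalue c' ∧
        2 * θ - focalAngle c = focalAngle c' + m * Real.pi := by
  have hR := hτ.reflectsFrame
  obtain ⟨X, hX, hX0⟩ := hc.exists_hasEigenvector
  set Y := mfderiv (𝓡 n) (𝓡 n) τ p X with hY
  obtain ⟨d1, d2⟩ := hR.mvfderiv_comp h p X
  have hX1 : mvfderiv (𝓡 n) (parallel F ν (focalAngle c)) p X = 0 := by
    have : X ∈ (mvfderiv (𝓡 n) (parallel F ν (focalAngle c)) p).ker := by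
      rw [h.ker_mvfderiv_parallel]
      exact hX
    exact this
  have hY0 : Y ≠ 0 := by
    intro hY0
    rw [← hY, hY0, map_zero] at d1 d2
    apply hX0
    apply h.injective_deriv_F p
    rw [map_zero, ← one_smul ℝ (mvfderiv (𝓡 n) F p X), ← hR.sq_add_sq]
    linear_combination (norm := module) (-Real.cos (2 * θ)) • d1 - Real.sin (2 * θ) • d2
  -- F_t ∘ τ is the parallel surface at the focal distance of c, so dτ carries the principal vector
  -- X into the kernel of dF_t at τ(p).
  set t := 2 * θ - focalAngle c with ht
  have hY1 : mvfderiv (𝓡 n) (parallel F ν t) (τ p) Y = 0 := by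
    refine (h.mvfderiv_linearComb _ _ (τ p) Y).trans ?_
    have hX2 := (h.mvfderiv_linearComb _ _ p X).symm.trans hX1
    have hcos : Real.cos (focalAngle c) =
        Real.cos (2 * θ) * Real.cos t + Real.sin (2 * θ) * Real.sin t := by
      rw [← Real.cos_sub, ht, sub_sub_cancel]
    have hsin : Real.sin (focalAngle c) =
        Real.sin (2 * θ) * Real.cos t - Real.cos (2 * θ) * Real.sin t := by
      rw [← Real.sin_sub, ht, sub_sub_cancel]
    rw [d1, d2, ← hX2, hcos, hsin]
    module
  rw [h.mvfderiv_parallel_eq_zero_iff] at hY1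
  -- If sin t = 0, then F_t = ±F is an immersion and has no kernel.
  have hst : Real.sin t ≠ 0 := by
    intro hst
    rw [hst, zero_smul, eq_comm, smul_eq_zero] at hY1
    have := Real.sin_sq_add_cos_sq t
    rw [hst, hY1.resolve_right hY0] at this
    norm_num at this
  have hYe : (shapeOperator F ν (τ p)).HasEigenvector (Real.cos t / Real.sin t) Y := by
    refine ⟨Module.End.mem_eigenspace_iff.2 ?_, hY0⟩
    rw [div_eq_inv_mul, mul_smul, ← hY1, smul_smul, inv_mul_cancel₀ hst, one_smul]
  obtain ⟨m, hm⟩ := exists_eq_focalAngle_add (θ := t) (c := Real.cos t / Real.sin t)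
    (by field_simp)
  exact ⟨_, m, Module.End.hasEigenvalue_of_hasEigenvector hYe, hm⟩

omit [IsManifold (𝓡 n) ∞ M]

/-- `σ` rotates the pair `(F, ν)` by the complex number `z`. -/
structure RotatesFrame (F ν : M → E (n + 2)) (z : ℂ) (σ : M → M) : Prop where
  map_fst : ∀ p, F (σ p) = z.re • F p + (-z.im) • ν p
  map_snd : ∀ p, ν (σ p) = z.im • F p + z.re • ν p

/-- `σ` changes the pair `(F, ν)` by the reflection that belongs to the complex number `z`. -/
structure ConjugatesFrame (F ν : M → E (n + 2)) (z : ℂ) (σ : M → M) : Prop where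
  map_fst : ∀ p, F (σ p) = z.re • F p + z.im • ν p
  map_snd : ∀ p, ν (σ p) = z.im • F p + (-z.re) • ν p

open ComplexConjugate

-- In complex notation `RotatesFrame` says (F + iν) ∘ σ = z (F + iν) and `ConjugatesFrame` says (F +
-- iν) ∘ σ = z (F - iν). The four composition rules are those of the maps w ↦ zw and w ↦ z w̄.
omit [TopologicalSpace M] [ChartedSpace (E n) M] in
theorem RotatesFrame.comp {z w : ℂ} {σ τ : M → M} (hσ : RotatesFrame F ν z σ)
    (hτ : RotatesFrame F ν w τ) : RotatesFrame F ν (z * w) (σ ∘ τ) := by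
  constructor <;> intro p <;>
    simp only [Function.comp_apply, hσ.map_fst, hσ.map_snd, hτ.map_fst, hτ.map_snd, Complex.mul_re,
      Complex.mul_im] <;> module

omit [TopologicalSpace M] [ChartedSpace (E n) M] in
theorem RotatesFrame.comp_conjugates {z w : ℂ} {σ τ : M → M} (hσ : RotatesFrame F ν z σ)
    (hτ : ConjugatesFrame F ν w τ) : ConjugatesFrame F ν (z * w) (σ ∘ τ) := by
  constructor <;> intro p <;>
    simp only [Function.comp_apply, hσ.map_fst, hσ.map_snd, hτ.map_fst, hτ.map_snd, Complex.mul_re,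
      Complex.mul_im] <;> module

omit [TopologicalSpace M] [ChartedSpace (E n) M] in
theorem ConjugatesFrame.comp_rotates {z w : ℂ} {σ τ : M → M} (hσ : ConjugatesFrame F ν z σ)
    (hτ : RotatesFrame F ν w τ) : ConjugatesFrame F ν (z * conj w) (σ ∘ τ) := by
  constructor <;> intro p <;>
    simp only [Function.comp_apply, hσ.map_fst, hσ.map_snd, hτ.map_fst, hτ.map_snd, Complex.mul_re,
      Complex.mul_im, Complex.conj_re, Complex.conj_im] <;> module

omit [TopologicalSpace M] [ChartedSpace (E n) M] in
theorem ConjugatesFrame.comp {z w : ℂ} {σ τ : M → M} (hσ : ConjugatesFrame F ν z σ)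
    (hτ : ConjugatesFrame F ν w τ) : RotatesFrame F ν (z * conj w) (σ ∘ τ) := by
  constructor <;> intro p <;>
    simp only [Function.comp_apply, hσ.map_fst, hσ.map_snd, hτ.map_fst, hτ.map_snd, Complex.mul_re,
      Complex.mul_im, Complex.conj_re, Complex.conj_im] <;> module

theorem RotatesFrame.unique (h : IsOrientedHypersurface F ν) {z : ℂ} {σ τ : M → M}
    (hσ : RotatesFrame F ν z σ) (hτ : RotatesFrame F ν z τ) : σ = τ :=
  funext fun p => h.isEmbedding_F.injective (by rw [hσ.map_fst, hτ.map_fst])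

theorem ConjugatesFrame.unique (h : IsOrientedHypersurface F ν) {z : ℂ} {σ τ : M → M}
    (hσ : ConjugatesFrame F ν z σ) (hτ : ConjugatesFrame F ν z τ) : σ = τ :=
  funext fun p => h.isEmbedding_F.injective (by rw [hσ.map_fst, hτ.map_fst])

theorem IsOrientedHypersurface.coeff_eq (h : IsOrientedHypersurface F ν) (p : M) {a b a' b' : ℝ}
    (hab : a • F p + b • ν p = a' • F p + b' • ν p) : a = a' ∧ b = b' := by
  have hFν : inner ℝ (F p) (ν p) = 0 := by rw [real_inner_comm]; exact h.inner_ν_F p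
  have e1 := congrArg (fun z => inner ℝ (F p) z) hab
  have e2 := congrArg (fun z => inner ℝ (ν p) z) hab
  simp only [inner_add_right, real_inner_smul_right, hFν, h.inner_ν_F,
    real_inner_self_eq_norm_sq, h.norm_F, h.norm_ν] at e1 e2
  constructor <;> linarith

theorem RotatesFrame.eq_one (h : IsOrientedHypersurface F ν) {z : ℂ} [Nonempty M]
    (hz : RotatesFrame F ν z id) : z = 1 := by
  obtain ⟨p⟩ := ‹Nonempty M›
  have := h.coeff_eq p (a := 1) (b := 0) (a' := z.re) (b' := -z.im)
    (by rw [← hz.map_fst]; simp)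
  exact Complex.ext this.1.symm (by simpa using this.2.symm)

theorem ConjugatesFrame.not_id (h : IsOrientedHypersurface F ν) {z : ℂ} [Nonempty M] :
    ¬ConjugatesFrame F ν z id := by
  intro hz
  obtain ⟨p⟩ := ‹Nonempty M›
  have h1 := h.coeff_eq p (a := 1) (b := 0) (a' := z.re) (b' := z.im)
    (by rw [← hz.map_fst]; simp)
  have h2 := h.coeff_eq p (a := 0) (b := 1) (a' := z.im) (b' := -z.re)
    (by rw [← hz.map_snd]; simp)
  linarith [h1.1, h2.2]

/-- Bijections that reflect the frame in the lines of a regular `g`-gon generate a dihedral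
group. -/
theorem IsOrientedHypersurface.exists_dihedralGroup_hom [Nonempty M]
    (h : IsOrientedHypersurface F ν) {g : ℕ} [NeZero g] {u : ℂ} (hu : u * conj u = 1)
    {τ : ZMod g → Equiv.Perm M}
    (hτ : ∀ k, ConjugatesFrame F ν (u * ZMod.stdAddChar k) (τ k)) :
    ∃ e : DihedralGroup g →* Equiv.Perm M, Function.Injective e ∧
      (∀ k, e (DihedralGroup.sr k) = τ k) := by
  have hχ : ∀ k : ZMod g, conj (ZMod.stdAddChar k : ℂ) = ZMod.stdAddChar (-k) := fun k => by
    rw [AddChar.map_neg_eq_conj]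
  -- The value on rotations is forced by r k = sr 0 * sr k. It turns the frame by the character at
  -- -k, because the second reflection contributes a conjugate. Multiplicativity then reduces to
  -- equality of complex factors, as F is injective.
  let e : DihedralGroup g → Equiv.Perm M := fun x =>
    match x with
    | .r k => τ 0 * τ k
    | .sr k => τ k
  have hr : ∀ k, RotatesFrame F ν (ZMod.stdAddChar (-k)) (e (.r k)) := by
    intro k
    have := (hτ 0).comp (hτ k)
    rw [map_mul, hχ, AddChar.map_zero_eq_one, mul_one, ← mul_assoc, hu, one_mul] at this
    exact this
  have hsr : ∀ k, ConjugatesFrame F ν (u * ZMod.stdAddChar k) (e (.sr k)) := hτ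
  have hmul : ∀ x y, e (x * y) = e x * e y := by
    intro x y
    apply Equiv.coe_fn_injective
    change ⇑(e (x * y)) = ⇑(e x) ∘ ⇑(e y)
    cases x with
    | r i =>
      cases y with
      | r j =>
        refine (hr (i + j)).unique h ?_
        have := (hr i).comp (hr j)
        rwa [← AddChar.map_add_eq_mul, ← neg_add] at this
      | sr j =>
        refine (hsr (j - i)).unique h ?_
        have := (hr i).comp_conjugates (hsr j)
        rwa [mul_left_comm, ← AddChar.map_add_eq_mul, neg_add_eq_sub] at this
    | sr i =>
      cases y with
      | r j =>
        refine (hsr (i + j)).unique h ?_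
        have := (hsr i).comp_rotates (hr j)
        rwa [hχ, neg_neg, mul_assoc, ← AddChar.map_add_eq_mul] at this
      | sr j =>
        refine (hr (j - i)).unique h ?_
        have := (hsr i).comp (hsr j)
        rwa [map_mul, hχ, mul_mul_mul_comm, hu, one_mul, ← AddChar.map_add_eq_mul,
          ← sub_eq_add_neg, ← neg_sub] at this
  -- A trivial rotation has character value 1, hence k = 0 by injectivity of the standard character;
  -- a reflection never fixes the frame.
  refine ⟨MonoidHom.mk' e hmul, (injective_iff_map_eq_one _).2 ?_, fun k => rfl⟩
  intro x hx
  have hx' : ⇑(e x) = id := by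
    change e x = 1 at hx
    rw [hx]
    rfl
  cases x with
  | r k =>
    have h1 := hr k
    rw [hx'] at h1
    have h2 := h1.eq_one h
    rw [← AddChar.map_zero_eq_one (ZMod.stdAddChar (N := g)), ZMod.injective_stdAddChar.eq_iff,
      neg_eq_zero] at h2
    rw [h2, DihedralGroup.r_zero]
  | sr k =>
    have h1 := hsr k
    rw [hx'] at h1
    exact absurd h1 (ConjugatesFrame.not_id h)

theorem range_eq_closure_of_dihedralGroup_hom {G : Type*} [Group G] {g : ℕ} [NeZero g]
    (e : DihedralGroup g →* G) : e.range =
      Subgroup.closure {e (DihedralGroup.sr 0), e (DihedralGroup.sr (-1))} := by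
  apply le_antisymm
  · set H := Subgroup.closure {e (DihedralGroup.sr 0), e (DihedralGroup.sr (-1))}
    have h0 : e (DihedralGroup.sr 0) ∈ H := Subgroup.subset_closure (by simp)
    have h1 : e (DihedralGroup.sr (-1)) ∈ H := Subgroup.subset_closure (by simp)
    have hr : ∀ k : ZMod g, e (DihedralGroup.r k) ∈ H := by
      intro k
      -- The product of the two generating reflections is the generator r 1 of the rotations. The
      -- index -1 modulo g stands for the last reflection.
      have : DihedralGroup.r k = (DihedralGroup.sr (-1) * DihedralGroup.sr 0) ^ k.val := by
        rw [DihedralGroup.sr_mul_sr, sub_neg_eq_add, zero_add, DihedralGroup.r_one_pow,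
          ZMod.natCast_zmod_val]
      rw [this, map_pow, map_mul]
      exact H.pow_mem (H.mul_mem h1 h0) _
    rintro _ ⟨x, rfl⟩
    cases x with
    | r k => exact hr k
    | sr k =>
      have : DihedralGroup.sr k = DihedralGroup.sr 0 * DihedralGroup.r k := by
        rw [DihedralGroup.sr_mul_r, zero_add]
      rw [this, map_mul]
      exact H.mul_mem h0 (hr k)
  · rw [Subgroup.closure_le]
    rintro _ (rfl | rfl) <;> exact ⟨_, rfl⟩

end Dihedral

/-! ### The focal reflections as a dihedral group -/

section Main

variable {n : ℕ} {M : Type*} [TopologicalSpace M] [ChartedSpace (E n) M] {F ν : M → E (n + 2)}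

theorem IsFocalReflection.unique (h : IsOrientedHypersurface F ν) {θ : ℝ}
    {τ τ' : M ≃ₘ^∞⟮𝓡 n, 𝓡 n⟯ M} (hτ : IsFocalReflection F ν θ τ)
    (hτ' : IsFocalReflection F ν θ τ') : τ = τ' :=
  DFunLike.coe_injective (hτ.reflectsFrame.unique h hτ'.reflectsFrame)

variable [IsManifold (𝓡 n) ∞ M]

/-- If all focal reflections exist, then the focal distances are equally spaced. -/
theorem IsOrientedHypersurface.focalAngle_eq_add [Nonempty M] (h : IsOrientedHypersurface F ν)
    {g : ℕ} (hg : 0 < g) {lam : Fin g → ℝ} (hlam : StrictAnti lam)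
    (hspec : ∀ (p : M) (x : ℝ), (shapeOperator F ν p).HasEigenvalue x ↔ ∃ j, lam j = x)
    {τ : Fin g → (M ≃ₘ^∞⟮𝓡 n, 𝓡 n⟯ M)}
    (hτ : ∀ j, IsFocalReflection F ν (focalAngle (lam j)) (τ j)) (j : Fin g) :
    focalAngle (lam j) = focalAngle (lam ⟨0, hg⟩) + (j : ℕ) * (Real.pi / g) := by
  obtain ⟨p⟩ := ‹Nonempty M›
  refine eq_add_mul_pi_div hg (θ := fun j => focalAngle (lam j))
    (focalAngle_strictAnti.comp hlam) (fun j => ?_) (fun j k => ?_) j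
  · have h1 := (focalAngle_mem_Ioo (lam j)).2
    have h2 := (focalAngle_mem_Ioo (lam ⟨0, hg⟩)).1
    linarith
  · obtain ⟨c, m, hc, hm⟩ :=
      h.exists_two_mul_sub_focalAngle (hτ j) ((hspec p (lam k)).2 ⟨k, rfl⟩)
    obtain ⟨l, rfl⟩ := (hspec _ _).1 hc
    exact ⟨l, m, hm⟩

-- A step π/g of the focal distance doubles to 2π/g in the matrix, so exp(2iθ) is exp(2iθ₀) times
-- the standard character at k.
omit [IsManifold (𝓡 n) ∞ M] in
theorem IsFocalReflection.conjugatesFrame {θ θ₀ : ℝ} {g : ℕ} [NeZero g] {k : ZMod g}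
    (hθ : θ = θ₀ + (k.val : ℕ) * (Real.pi / g)) {τ : M ≃ₘ^∞⟮𝓡 n, 𝓡 n⟯ M}
    (hτ : IsFocalReflection F ν θ τ) :
    ConjugatesFrame F ν (Complex.exp ((2 * θ₀ : ℝ) * Complex.I) * ZMod.stdAddChar k) τ := by
  have hg : (g : ℂ) ≠ 0 := by exact_mod_cast NeZero.ne g
  have hz : Complex.exp ((2 * θ₀ : ℝ) * Complex.I) * ZMod.stdAddChar k =
      Complex.exp ((2 * θ : ℝ) * Complex.I) := by
    have hk : ZMod.stdAddChar k =
        Complex.exp (2 * Real.pi * Complex.I * ((k.val : ℕ) : ℤ) / g) := by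
      rw [← ZMod.stdAddChar_coe]
      congr 1
      simp
    rw [hk, ← Complex.exp_add, hθ]
    congr 1
    push_cast
    field_simp
  have hR := hτ.reflectsFrame
  rw [hz]
  constructor <;> intro p
  · rw [Complex.exp_ofReal_mul_I_re, Complex.exp_ofReal_mul_I_im]
    exact hR.map_fst p
  · rw [Complex.exp_ofReal_mul_I_re, Complex.exp_ofReal_mul_I_im]
    exact hR.map_snd p

/-- The focal reflections are the reflections of a dihedral group. -/
theorem IsOrientedHypersurface.exists_dihedralGroup_hom_focalReflections [Nonempty M]
    (h : IsOrientedHypersurface F ν) {g : ℕ} (hg : 0 < g) {lam : Fin g → ℝ} (hlam : StrictAnti lam)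
    (hspec : ∀ (p : M) (x : ℝ), (shapeOperator F ν p).HasEigenvalue x ↔ ∃ j, lam j = x)
    {τ : Fin g → (M ≃ₘ^∞⟮𝓡 n, 𝓡 n⟯ M)}
    (hτ : ∀ j, IsFocalReflection F ν (focalAngle (lam j)) (τ j)) :
    ∃ e : DihedralGroup g →* Equiv.Perm M, Function.Injective e ∧
      e.range = Subgroup.closure
        {(τ ⟨0, hg⟩).toEquiv, (τ ⟨g - 1, Nat.sub_lt hg Nat.one_pos⟩).toEquiv} ∧
      range (fun k : ZMod g => e (DihedralGroup.sr k)) =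
        range (fun j : Fin g => (τ j).toEquiv) := by
  have : NeZero g := ⟨hg.ne'⟩
  set θ₀ := focalAngle (lam ⟨0, hg⟩) with hθ₀
  have hu : Complex.exp ((2 * θ₀ : ℝ) * Complex.I) *
      (starRingEnd ℂ) (Complex.exp ((2 * θ₀ : ℝ) * Complex.I)) = 1 := by
    rw [Complex.mul_conj, Complex.normSq_eq_norm_sq, Complex.norm_exp_ofReal_mul_I]
    simp
  obtain ⟨e, he, hsr⟩ := h.exists_dihedralGroup_hom (g := g) hu
    (τ := fun k => (τ ⟨k.val, ZMod.val_lt k⟩).toEquiv) fun k =>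
      (hτ ⟨k.val, ZMod.val_lt k⟩).conjugatesFrame (h.focalAngle_eq_add hg hlam hspec hτ _)
  have hval : ∀ {k : ZMod g} {j : Fin g}, k.val = j → e (DihedralGroup.sr k) = (τ j).toEquiv := by
    rintro k ⟨j, hj⟩ rfl
    exact hsr k
  have hcast : ∀ j : Fin g, ((j : ℕ) : ZMod g).val = j := fun j => ZMod.val_natCast_of_lt j.2
  refine ⟨e, he, ?_, ?_⟩
  · rw [range_eq_closure_of_dihedralGroup_hom e, hval (j := ⟨0, hg⟩) ZMod.val_zero,
      hval (j := ⟨g - 1, Nat.sub_lt hg Nat.one_pos⟩)]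
    have : (-1 : ZMod g) = ((g - 1 : ℕ) : ZMod g) := by
      rw [Nat.cast_sub hg, ZMod.natCast_self, zero_sub, Nat.cast_one]
    rw [this]
    exact hcast ⟨g - 1, Nat.sub_lt hg Nat.one_pos⟩
  · ext x
    constructor
    · rintro ⟨k, rfl⟩
      exact ⟨⟨k.val, ZMod.val_lt k⟩, (hsr k).symm⟩
    · rintro ⟨j, rfl⟩
      exact ⟨(j : ℕ), hval (hcast j)⟩

end Main

end Isoparametric

end

theorem mainTheorem5 {n g : ℕ} {M : Type*} [TopologicalSpace M]
    [ChartedSpace (EuclideanSpace ℝ (Fin n)) M] [IsManifold (𝓡 n) ∞ M] [ConnectedSpace M]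
    (F ν : M → EuclideanSpace ℝ (Fin (n + 2))) (hF : Isoparametric.IsIsoparametric F ν)
    (hg : 0 < g) (lam : Fin g → ℝ) (hlam : StrictAnti lam)
    (hspec : ∀ (p : M) (x : ℝ),
      (Isoparametric.shapeOperator F ν p).HasEigenvalue x ↔ ∃ j, lam j = x) :
    -- on a compact hypersurface the reflections exist, and they are unique
    (CompactSpace M → ∀ j : Fin g, ∃! τ : M ≃ₘ^∞⟮𝓡 n, 𝓡 n⟯ M,
      Isoparametric.IsFocalReflection F ν (Isoparametric.focalAngle (lam j)) τ) ∧
    -- each reflection is an involutive isometry of `ĝ` that reverses `α` and all `∇ⁱα`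
    (∀ (j : Fin g) (τ : M ≃ₘ^∞⟮𝓡 n, 𝓡 n⟯ M),
      Isoparametric.IsFocalReflection F ν (Isoparametric.focalAngle (lam j)) τ →
      (∀ p, τ (τ p) = p) ∧
      (∀ (p : M) (X Y : TangentSpace (𝓡 n) p),
        Isoparametric.gHat F ν p X Y =
          Isoparametric.gHat F ν (τ p) (mfderiv (𝓡 n) (𝓡 n) τ p X)
            (mfderiv (𝓡 n) (𝓡 n) τ p Y)) ∧
      (∀ (p : M) (X Y Z : TangentSpace (𝓡 n) p),
        Isoparametric.alpha F ν p X Y Z =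
          -Isoparametric.alpha F ν (τ p) (mfderiv (𝓡 n) (𝓡 n) τ p X)
            (mfderiv (𝓡 n) (𝓡 n) τ p Y) (mfderiv (𝓡 n) (𝓡 n) τ p Z)) ∧
      (∀ (i : ℕ) (p : M) (w : Fin (3 + i) → TangentSpace (𝓡 n) p),
        Isoparametric.nablaAlpha F ν i p w =
          -Isoparametric.nablaAlpha F ν i (τ p) fun s => mfderiv (𝓡 n) (𝓡 n) τ p (w s))) ∧
    -- the reflections are the reflections of the dihedral group generated by the first and the last
    (∀ τ : Fin g → (M ≃ₘ^∞⟮𝓡 n, 𝓡 n⟯ M),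
      (∀ j, Isoparametric.IsFocalReflection F ν (Isoparametric.focalAngle (lam j)) (τ j)) →
      ∃ e : DihedralGroup g →* Equiv.Perm M,
        Function.Injective e ∧
        e.range = Subgroup.closure
          {(τ ⟨0, hg⟩).toEquiv, (τ ⟨g - 1, Nat.sub_lt hg Nat.one_pos⟩).toEquiv} ∧
        Set.range (fun k : ZMod g => e (DihedralGroup.sr k)) =
          Set.range (fun j : Fin g => (τ j).toEquiv)) := by
  have h := hF.toIsOrientedHypersurface
  refine ⟨fun _ j => ?_, fun j τ hτ => ?_, fun τ hτ => ?_⟩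
  · obtain ⟨τ, hτ⟩ := hF.exists_isFocalReflection fun p => (hspec p (lam j)).2 ⟨j, rfl⟩
    exact ⟨τ, hτ, fun τ' hτ' => hτ'.unique h hτ⟩
  · have hR := hτ.reflectsFrame
    exact ⟨hR.involutive h, hR.gHat_eq h, hR.alpha_eq h, hR.nablaAlpha_eq h⟩
  · exact h.exists_dihedralGroup_hom_focalReflections hg hlam hspec hτ
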